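/- Let $\mathbb D=\{z\in\mathbb C:|z|<1\}$ and let $H^2$ be the Hardy space of holomorphic functions $f$ on $\mathbb D$ with $\sup_{0\le r<1}\frac1{2\pi}\int_0^{2\pi}|f(re^{i\theta})|^2\,d\theta<\infty$, with its usual inner product $\langle f,g\rangle=\lim_{r\to1^-}\frac1{2\pi}\int_0^{2\pi}f(re^{i\theta})\overline{g(re^{i\theta})}\,d\theta$. For $\beta\in\mathbb C$ with $|\beta|=1$ and $\lambda\in\mathbb D\setminus\{0\}$, let $\mathcal J_{\beta,\lambda}$ be the weighted composition conjugation $$ \mathcal J_{\beta,\lambda}f(z)=\beta\,\kappa(z)\,\overline{f\big(\overline{\varphi(z)}\big)},\qquad \kappa(z)=\frac{\sqrt{1-|\lambda|^2}}{1-z\overline\lambda},\qquad \varphi(z)=\frac{\overline\lambda}{\lambda}\cdot\frac{\lambda-z}{1-z\overline\lambda},\qquad f\in H^2,\ z\in\mathbb D, $$ which is an antilinear isometric involution of $H^2$. Let $\psi_0,\psi_1:\mathbb D\to\mathbb C$ be holomorphic, and let $\mathcal E_{\max}$ be the maximal differential operator $$ \mathrm{dom}(\mathcal E_{\max})=\{f\in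 H^2:\ \psi_0f+\psi_1f'\in H^2\},\qquad \mathcal E_{\max}f=\psi_0f+\psi_1f'. $$ For unbounded operators, $X\preceq Y$ means $\mathrm{dom}(X)\subseteq\mathrm{dom}(Y)$ and $Xf=Yf$ for all $f\in\mathrm{dom}(X)$; for a conjugation $\mathcal C$ and an operator $S$, the operator $\mathcal CS\mathcal C$ has domain $\{f:\mathcal Cf\in\mathrm{dom}(S)\}$; and $S$ is called $\mathcal C$-selfadjoint if it is densely defined and $S=\mathcal CS^*\mathcal C$. Then the following assertions are equivalent. 1. $\mathcal E_{\max}$ is $\mathcal J_{\beta,\lambda}$-selfadjoint. 2. $\mathrm{dom}(\mathcal E_{\max})$ is dense in $H^2$ and $\mathcal E_{\max}^*\preceq\mathcal J_{\beta,\lambda}\mathcal E_{\max}\mathcal J_{\beta,\lambda}$. 3. There are constants $a,b,c\in\mathbb C$ such that, with $d=-\lambda b\,\overline\lambda^{-1}-\lambda c$, $$ \psi_0(u)=a+bu,\qquad \psi_1(u)=d+cu+bu^2\qquad\text{for all }u\in\mathbb D. $$ -/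

import Mathlib

open scoped ComplexConjugate
open Complex Metric

noncomputable section

namespace Hardy

/-! ### The Hardy space of the unit disc -/

/-- The elements of the Hardy space `H²`: holomorphic functions on the open unit disc whose mean
square value on the circle of radius `r` stays bounded as `r → 1⁻`.  A function on the disc is
represented by its extension by zero to the complex plane. -/
def IsHardy (f : ℂ → ℂ) : Prop :=
  DifferentiableOn ℂ f (ball 0 1) ∧
    (∃ M : ℝ, ∀ r : ℝ, 0 ≤ r → r < 1 → Real.circleAverage (fun z => ‖f z‖ ^ 2) 0 r ≤ M) ∧
    ∀ z ∉ ball (0 : ℂ) 1, f z = 0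

theorem continuous_circleMap_comp {f : ℂ → ℂ} (hf : DifferentiableOn ℂ f (ball 0 1)) {r : ℝ}
    (h0 : 0 ≤ r) (h1 : r < 1) : Continuous (fun θ : ℝ => f (circleMap 0 r θ)) := by
  refine hf.continuousOn.comp_continuous (by fun_prop) (fun θ => ?_)
  simp [abs_of_nonneg h0, h1]

theorem circleIntegrable_of {E : Type*} [NormedAddCommGroup E] {f : ℂ → E} {r : ℝ}
    (h : Continuous (fun θ : ℝ => f (circleMap 0 r θ))) : CircleIntegrable f 0 r :=
  h.intervalIntegrable _ _

theorem circleIntegrable_sq {f : ℂ → ℂ} (hf : DifferentiableOn ℂ f (ball 0 1)) {r : ℝ}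
    (h0 : 0 ≤ r) (h1 : r < 1) : CircleIntegrable (fun z => ‖f z‖ ^ 2) 0 r :=
  circleIntegrable_of ((continuous_circleMap_comp hf h0 h1).norm.pow 2)

/-- The Hardy space as a space of functions. -/
def hardySubmodule : Submodule ℂ (ℂ → ℂ) where
  carrier := {f | IsHardy f}
  zero_mem' := ⟨differentiableOn_const 0, ⟨0, fun r _ _ => by simp [Real.circleAverage_def]⟩,
    fun _ _ => rfl⟩
  add_mem' := by
    rintro f g ⟨hf, ⟨M, hM⟩, hf0⟩ ⟨hg, ⟨N, hN⟩, hg0⟩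
    refine ⟨hf.add hg, ⟨2 * M + 2 * N, fun r h0 h1 => ?_⟩,
      fun z hz => by simp [hf0 z hz, hg0 z hz]⟩
    have hF := circleIntegrable_sq hf h0 h1
    have hG := circleIntegrable_sq hg h0 h1
    have e : Real.circleAverage (fun z => 2 * ‖f z‖ ^ 2 + 2 * ‖g z‖ ^ 2) 0 r
        = 2 * Real.circleAverage (fun z => ‖f z‖ ^ 2) 0 r
          + 2 * Real.circleAverage (fun z => ‖g z‖ ^ 2) 0 r := by
      have h := Real.circleAverage_fun_add (hF.const_smul (a := (2 : ℝ)))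
        (hG.const_smul (a := (2 : ℝ)))
      rw [Real.circleAverage_smul, Real.circleAverage_smul] at h
      exact h
    calc Real.circleAverage (fun z => ‖(f + g) z‖ ^ 2) 0 r
        ≤ Real.circleAverage (fun z => 2 * ‖f z‖ ^ 2 + 2 * ‖g z‖ ^ 2) 0 r := by
          refine Real.circleAverage_mono (circleIntegrable_sq (hf.add hg) h0 h1) ?_ ?_
          · refine circleIntegrable_of ?_
            exact ((continuous_circleMap_comp hf h0 h1).norm.pow 2 |>.const_mul 2).add
              ((continuous_circleMap_comp hg h0 h1).norm.pow 2 |>.const_mul 2)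
          · intro z _
            have := norm_add_le (f z) (g z)
            have h2 := norm_nonneg (f z + g z)
            simp only [Pi.add_apply]
            nlinarith [sq_nonneg (‖f z‖ - ‖g z‖)]
      _ ≤ 2 * M + 2 * N := by rw [e]; linarith [hM r h0 h1, hN r h0 h1]
  smul_mem' := by
    rintro c f ⟨hf, ⟨M, hM⟩, hf0⟩
    refine ⟨hf.const_smul c, ⟨‖c‖ ^ 2 * M, fun r h0 h1 => ?_⟩, fun z hz => by simp [hf0 z hz]⟩
    have e : Real.circleAverage (fun z => ‖(c • f) z‖ ^ 2) 0 r
        = ‖c‖ ^ 2 * Real.circleAverage (fun z => ‖f z‖ ^ 2) 0 r := by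
      have := Real.circleAverage_fun_smul (𝕜 := ℝ) (c := 0) (R := r) (a := ‖c‖ ^ 2)
        (f := fun z => ‖f z‖ ^ 2)
      simpa [mul_pow] using this
    rw [e]
    exact mul_le_mul_of_nonneg_left (hM r h0 h1) (by positivity)

/-- The Hardy space `H²` of the unit disc. -/
def H2 : Type := hardySubmodule

namespace H2

instance : AddCommGroup H2 := inferInstanceAs (AddCommGroup hardySubmodule)

instance : Module ℂ H2 := inferInstanceAs (Module ℂ hardySubmodule)

instance : CoeFun H2 (fun _ => ℂ → ℂ) := ⟨fun f => f.1⟩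

theorem ext_fun {f g : H2} (h : ∀ z ∈ ball (0 : ℂ) 1, f z = g z) : f = g := by
  refine Subtype.ext (funext fun z => ?_)
  by_cases hz : z ∈ ball (0 : ℂ) 1
  · exact h z hz
  · rw [f.2.2.2 z hz, g.2.2.2 z hz]

theorem coe_add (f g : H2) : ⇑(f + g) = ⇑f + ⇑g := rfl

theorem coe_smul (c : ℂ) (f : H2) : ⇑(c • f) = c • ⇑f := rfl

theorem diff (f : H2) : DifferentiableOn ℂ f (ball 0 1) := f.2.1

end H2

/-! ### Taylor coefficients and the inner product -/

/-- The `n`-th Taylor coefficient at the origin. -/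
def coeff (f : ℂ → ℂ) (n : ℕ) : ℂ := (n.factorial : ℂ)⁻¹ * iteratedDeriv n f 0

/-- `f` is the sum of the power series with coefficients `a` on the unit disc. -/
def Rep (a : ℕ → ℂ) (f : ℂ → ℂ) : Prop := ∀ z ∈ ball (0 : ℂ) 1, HasSum (fun n => a n * z ^ n) (f z)

theorem rep_coeff {f : ℂ → ℂ} (hf : DifferentiableOn ℂ f (ball 0 1)) : Rep (coeff f) f := by
  intro z hz
  have h := Complex.hasSum_taylorSeries_on_ball hf hz
  have e : (fun n => coeff f n * z ^ n)
      = fun n : ℕ => (n.factorial : ℂ)⁻¹ • (z - 0) ^ n • iteratedDeriv n f 0 := by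
    funext n
    simp only [coeff, smul_eq_mul, sub_zero]
    ring
  rw [e]
  exact h

theorem Rep.summable {a : ℕ → ℂ} {f : ℂ → ℂ} (h : Rep a f) {r : ℝ} (h0 : 0 ≤ r) (h1 : r < 1) :
    Summable (fun n => ‖a n‖ * r ^ n) := by
  have := (h (r : ℂ) (by simp [abs_of_nonneg h0, h1])).summable.norm
  simpa [abs_of_nonneg h0] using this

theorem avg_hasSum {a : ℕ → ℂ} {f : ℂ → ℂ} (h : Rep a f) {r : ℝ} (h0 : 0 ≤ r) (h1 : r < 1)
    {k : ℂ → ℂ} (hk : Continuous (fun θ : ℝ => k (circleMap 0 r θ))) :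
    HasSum (fun n => a n * Real.circleAverage (fun z => k z * z ^ n) 0 r)
      (Real.circleAverage (fun z => k z * f z) 0 r) := by
  obtain ⟨C, hC⟩ := (isCompact_Icc (a := (0 : ℝ)) (b := 2 * Real.pi)).exists_bound_of_continuousOn
    hk.continuousOn
  have hnorm : ∀ θ : ℝ, ‖circleMap 0 r θ‖ = r := fun θ => by simp [abs_of_nonneg h0]
  have key : HasSum
      (fun n => ∫ θ in (0 : ℝ)..2 * Real.pi, a n * (k (circleMap 0 r θ) * circleMap 0 r θ ^ n))
      (∫ θ in (0 : ℝ)..2 * Real.pi, k (circleMap 0 r θ) * f (circleMap 0 r θ)) := by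
    refine intervalIntegral.hasSum_integral_of_dominated_convergence
      (fun n _ => C * (‖a n‖ * r ^ n)) ?_ ?_ ?_ ?_ ?_
    · intro n
      exact (continuous_const.mul
        (hk.mul ((continuous_circleMap 0 r).pow n))).aestronglyMeasurable
    · intro n
      refine Filter.Eventually.of_forall fun θ hθ => ?_
      rw [Set.uIoc_of_le (by positivity)] at hθ
      have := hC θ ⟨hθ.1.le, hθ.2⟩
      rw [norm_mul, norm_mul, norm_pow, hnorm]
      have : ‖a n‖ * (‖k (circleMap 0 r θ)‖ * r ^ n) = ‖k (circleMap 0 r θ)‖ * (‖a n‖ * r ^ n) := by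
        ring
      rw [this]
      gcongr
    · exact Filter.Eventually.of_forall fun θ _ => (h.summable h0 h1).mul_left C
    · exact intervalIntegrable_const
    · refine Filter.Eventually.of_forall fun θ _ => ?_
      have := (h (circleMap 0 r θ) (by simp [abs_of_nonneg h0, h1])).mul_left (k (circleMap 0 r θ))
      rw [show (fun n => a n * (k (circleMap 0 r θ) * circleMap 0 r θ ^ n))
        = fun n => k (circleMap 0 r θ) * (a n * circleMap 0 r θ ^ n) from funext fun n => by ring]
      exact this
  have := key.const_smul ((2 * Real.pi)⁻¹ : ℝ)
  simp only [Real.circleAverage_def]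
  convert this using 2 with n
  rw [intervalIntegral.integral_const_mul, mul_smul_comm]

theorem avg_monomial (r : ℝ) (m n : ℕ) :
    Real.circleAverage (fun z => conj (z ^ m) * z ^ n) 0 r
      = if m = n then ((r ^ (2 * n) : ℝ) : ℂ) else 0 := by
  have e : ∀ θ : ℝ, conj (circleMap 0 r θ ^ m) * circleMap 0 r θ ^ n
      = (r : ℂ) ^ (m + n) * exp (((n : ℂ) - m) * I * θ) := by
    intro θ
    simp only [circleMap, zero_add, map_pow, map_mul, conj_ofReal, conj_natCast, ← exp_conj, conj_I, mul_pow,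
      ← exp_nat_mul, pow_add]
    rw [mul_mul_mul_comm, ← exp_add]
    congr 2
    ring
  rw [Real.circleAverage_def]
  simp only [e]
  rw [intervalIntegral.integral_const_mul]
  split_ifs with h
  · subst h
    simp only [sub_self, zero_mul, exp_zero, intervalIntegral.integral_const, sub_zero]
    have : (Real.pi : ℂ) ≠ 0 := by exact_mod_cast Real.pi_ne_zero
    simp only [real_smul]
    push_cast
    field_simp
    ring
  · have hc : ((n : ℂ) - m) * I ≠ 0 :=
      mul_ne_zero (sub_ne_zero.2 (by exact_mod_cast Ne.symm h)) I_ne_zero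
    rw [integral_exp_mul_complex hc]
    have : exp (((n : ℂ) - m) * I * ((2 * Real.pi : ℝ) : ℂ)) = 1 := by
      rw [exp_eq_one_iff]
      exact ⟨(n : ℤ) - m, by push_cast; ring⟩
    rw [this]
    simp

/-- Parseval's identity on the circle of radius `r < 1`. -/
theorem avg_inner {a b : ℕ → ℂ} {f g : ℂ → ℂ} (hf : Rep a f) (hg : Rep b g)
    (cf : DifferentiableOn ℂ f (ball 0 1)) {r : ℝ} (h0 : 0 ≤ r) (h1 : r < 1) :
    HasSum (fun n => conj (a n) * b n * ((r ^ (2 * n) : ℝ) : ℂ))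
      (Real.circleAverage (fun z => conj (f z) * g z) 0 r) := by
  have cf' := continuous_circleMap_comp cf h0 h1
  have H := avg_hasSum hg h0 h1 (k := fun z => conj (f z))
    (continuous_conj.comp cf')
  convert H using 2 with n
  have G := avg_hasSum hf h0 h1 (k := fun z => conj (z ^ n))
    (continuous_conj.comp ((continuous_circleMap 0 r).pow n))
  have G' : HasSum (fun m => a m * Real.circleAverage (fun z => conj (z ^ n) * z ^ m) 0 r)
      (a n * ((r ^ (2 * n) : ℝ) : ℂ)) := by
    convert hasSum_single n ?_ using 1
    · rw [avg_monomial, if_pos rfl]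
    · intro m hm
      rw [avg_monomial, if_neg (Ne.symm hm), mul_zero]
  have E := G.unique G'
  have E2 : Real.circleAverage (fun z => conj (f z) * z ^ n) 0 r
      = conj (Real.circleAverage (fun z => conj (z ^ n) * f z) 0 r) := by
    simp only [Real.circleAverage_def, real_smul, map_mul, conj_ofReal]
    congr 1
    rw [intervalIntegral.integral_of_le (by positivity),
      intervalIntegral.integral_of_le (by positivity), ← integral_conj]
    congr 1
    funext θ
    simp [mul_comm]
  rw [E2, E]
  simp only [map_mul, conj_ofReal]
  ring

theorem avg_sq {a : ℕ → ℂ} {f : ℂ → ℂ} (hf : Rep a f) (cf : DifferentiableOn ℂ f (ball 0 1))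
    {r : ℝ} (h0 : 0 ≤ r) (h1 : r < 1) :
    HasSum (fun n => ‖a n‖ ^ 2 * r ^ (2 * n)) (Real.circleAverage (fun z => ‖f z‖ ^ 2) 0 r) := by
  have H := avg_inner hf hf cf h0 h1
  have e : Real.circleAverage (fun z => conj (f z) * f z) 0 r
      = ((Real.circleAverage (fun z => ‖f z‖ ^ 2) 0 r : ℝ) : ℂ) := by
    simp only [Real.circleAverage_def, real_smul, smul_eq_mul, conj_mul', ofReal_mul,
      ← intervalIntegral.integral_ofReal, ofReal_pow]
  rw [e] at H
  have e2 : (fun n => conj (a n) * a n * ((r ^ (2 * n) : ℝ) : ℂ))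
      = fun n => ((‖a n‖ ^ 2 * r ^ (2 * n) : ℝ) : ℂ) := by
    funext n
    rw [conj_mul']
    push_cast
    rfl
  rw [e2] at H
  exact hasSum_ofReal.1 H

theorem Rep.unique {a b : ℕ → ℂ} {f : ℂ → ℂ} (ha : Rep a f) (hb : Rep b f) : a = b := by
  funext n
  have key : ∀ {c : ℕ → ℂ}, Rep c f →
      Real.circleAverage (fun z => conj (z ^ n) * f z) 0 (1 / 2)
        = c n * (((1 / 2 : ℝ) ^ (2 * n) : ℝ) : ℂ) := by
    intro c hc
    have G := avg_hasSum hc (r := 1 / 2) (by norm_num) (by norm_num)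
      (k := fun z => conj (z ^ n))
      (continuous_conj.comp ((continuous_circleMap 0 (1 / 2)).pow n))
    refine G.unique ?_
    convert hasSum_single n ?_ using 1
    · rw [avg_monomial, if_pos rfl]
    · intro m hm
      rw [avg_monomial, if_neg (Ne.symm hm), mul_zero]
  have h := (key ha).symm.trans (key hb)
  exact mul_right_cancel₀ (by norm_num) h

theorem coeff_eq {a : ℕ → ℂ} {f : ℂ → ℂ} (hf : DifferentiableOn ℂ f (ball 0 1)) (h : Rep a f) :
    coeff f = a := (rep_coeff hf).unique h

theorem summable_sq_of_isHardy {f : ℂ → ℂ} (hf : IsHardy f) :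
    Summable (fun n => ‖coeff f n‖ ^ 2) := by
  obtain ⟨M, hM⟩ := hf.2.1
  refine summable_of_sum_range_le (c := M) (fun n => by positivity) (fun N => ?_)
  have hc : Filter.Tendsto (fun r : ℝ => ∑ n ∈ Finset.range N, ‖coeff f n‖ ^ 2 * r ^ (2 * n))
      (nhdsWithin 1 (Set.Iio 1)) (nhds (∑ n ∈ Finset.range N, ‖coeff f n‖ ^ 2 * 1 ^ (2 * n))) := by
    refine Filter.Tendsto.mono_left ?_ nhdsWithin_le_nhds
    exact (Continuous.tendsto (by fun_prop) 1)
  simp only [one_pow, mul_one] at hc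
  refine le_of_tendsto hc ?_
  filter_upwards [Ioo_mem_nhdsLT (show (0 : ℝ) < 1 by norm_num)] with r hr
  have h := avg_sq (rep_coeff hf.1) hf.1 hr.1.le hr.2
  refine (sum_le_hasSum _ (fun n _ => ?_) h).trans (hM r hr.1.le hr.2)
  have := hr.1.le
  positivity

/-- The sum of a power series, extended by zero off the unit disc. -/
def ofCoeff (a : ℕ → ℂ) : ℂ → ℂ := (ball 0 1).indicator fun z => ∑' n, a n * z ^ n

theorem summable_of_bounded {a : ℕ → ℂ} {C : ℝ} (hC : ∀ n, ‖a n‖ ≤ C) {r : ℝ} (h0 : 0 ≤ r)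
    (h1 : r < 1) : Summable (fun n => ‖a n‖ * r ^ n) := by
  refine Summable.of_nonneg_of_le (fun n => by positivity) (fun n => ?_)
    ((summable_geometric_of_lt_one h0 h1).mul_left C)
  gcongr
  exact hC n

theorem rep_ofCoeff {a : ℕ → ℂ} {C : ℝ} (hC : ∀ n, ‖a n‖ ≤ C) : Rep a (ofCoeff a) := by
  intro z hz
  rw [ofCoeff, Set.indicator_of_mem hz]
  have hz' : ‖z‖ < 1 := by simpa using hz
  refine (Summable.of_norm ?_).hasSum
  simpa using summable_of_bounded hC (norm_nonneg z) hz'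

theorem differentiableOn_ofCoeff {a : ℕ → ℂ} {C : ℝ} (hC : ∀ n, ‖a n‖ ≤ C) :
    DifferentiableOn ℂ (ofCoeff a) (ball 0 1) := by
  refine DifferentiableOn.congr (f := fun z => ∑' n, a n * z ^ n) ?_
    (fun z hz => Set.indicator_of_mem hz _)
  intro z hz
  obtain ⟨s, hs1, hs2⟩ := exists_between (show ‖z‖ < 1 by simpa using hz)
  have h0 : 0 ≤ s := (norm_nonneg z).trans hs1.le
  have := differentiableOn_tsum_of_summable_norm (summable_of_bounded hC h0 hs2)
    (F := fun n z => a n * z ^ n) (U := ball (0 : ℂ) s)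
    (fun n => (by fun_prop : Differentiable ℂ fun z : ℂ => a n * z ^ n).differentiableOn)
    isOpen_ball (fun n w hw => by
      have hw' : ‖w‖ < s := by simpa using hw
      rw [norm_mul, norm_pow]
      gcongr)
  exact (this.differentiableAt (isOpen_ball.mem_nhds (by simpa using hs1))).differentiableWithinAt

theorem norm_le_of_summable {a : ℕ → ℂ} (h : Summable (fun n => ‖a n‖ ^ 2)) (n : ℕ) :
    ‖a n‖ ≤ √(∑' n, ‖a n‖ ^ 2) :=
  Real.le_sqrt_of_sq_le (h.le_tsum n (fun _ _ => by positivity))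

theorem isHardy_ofCoeff {a : ℕ → ℂ} (h : Summable (fun n => ‖a n‖ ^ 2)) :
    IsHardy (ofCoeff a) := by
  have hd := differentiableOn_ofCoeff (norm_le_of_summable h)
  refine ⟨hd, ⟨∑' n, ‖a n‖ ^ 2, fun r h0 h1 => ?_⟩, fun z hz => Set.indicator_of_notMem hz _⟩
  refine hasSum_le (fun n => ?_) (avg_sq (rep_ofCoeff (norm_le_of_summable h)) hd h0 h1) h.hasSum
  exact mul_le_of_le_one_right (by positivity) (pow_le_one₀ h0 h1.le)

theorem memℓp_two_iff {a : ℕ → ℂ} : Memℓp a 2 ↔ Summable (fun n => ‖a n‖ ^ 2) := by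
  rw [memℓp_gen_iff (by norm_num)]
  simp

namespace H2

/-- A function in `H²` is determined by its sequence of Taylor coefficients, and the sequences that
occur are exactly those in `ℓ²`. -/
def toLp : H2 ≃ₗ[ℂ] lp (fun _ : ℕ => ℂ) 2 where
  toFun f := ⟨coeff f, memℓp_two_iff.2 (summable_sq_of_isHardy f.2)⟩
  map_add' f g := by
    refine Subtype.ext (coeff_eq (f + g).diff fun z hz => ?_)
    have := (rep_coeff f.diff z hz).add (rep_coeff g.diff z hz)
    rw [show (fun n => coeff f n * z ^ n + coeff g n * z ^ n)
      = fun n => (coeff f + coeff g) n * z ^ n from funext fun n => (add_mul _ _ _).symm] at this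
    exact this
  map_smul' c f := by
    refine Subtype.ext (coeff_eq (c • f).diff fun z hz => ?_)
    have := (rep_coeff f.diff z hz).mul_left c
    rw [show (fun n => c * (coeff f n * z ^ n))
      = fun n => (c • coeff f) n * z ^ n from funext fun n => (mul_assoc _ _ _).symm] at this
    exact this
  invFun a := ⟨ofCoeff a, isHardy_ofCoeff (memℓp_two_iff.1 a.2)⟩
  left_inv f := by
    refine ext_fun fun z hz => ?_
    have h := summable_sq_of_isHardy f.2
    exact (rep_ofCoeff (norm_le_of_summable h) z hz).unique (rep_coeff f.diff z hz)
  right_inv a := by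
    have h := memℓp_two_iff.1 a.2
    exact Subtype.ext (coeff_eq (differentiableOn_ofCoeff (norm_le_of_summable h))
      (rep_ofCoeff (norm_le_of_summable h)))

theorem toLp_apply (f : H2) (n : ℕ) : toLp f n = coeff f n := rfl

instance : NormedAddCommGroup H2 :=
  NormedAddCommGroup.induced H2 (lp (fun _ : ℕ => ℂ) 2) toLp toLp.injective

theorem inner_toLp (f g : H2) :
    inner ℂ (toLp f) (toLp g) = ∑' n, conj (coeff f n) * coeff g n := by
  rw [lp.inner_eq_tsum]
  simp [toLp_apply, mul_comm]

/-- The inner product `⟪f, g⟫ = ∑ₙ conj (aₙ) bₙ` of `f = ∑ aₙ zⁿ` and `g = ∑ bₙ zⁿ` (conjugate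
linear in the first argument, as always in Mathlib). -/
instance : InnerProductSpace ℂ H2 where
  norm_smul_le c f := by
    change ‖toLp (c • f)‖ ≤ ‖c‖ * ‖toLp f‖
    rw [map_smul, norm_smul]
  inner f g := ∑' n, conj (coeff f n) * coeff g n
  norm_sq_eq_re_inner f := by
    rw [← inner_toLp]
    exact norm_sq_eq_re_inner (𝕜 := ℂ) (toLp f)
  conj_inner_symm f g := by
    rw [← inner_toLp, ← inner_toLp]
    exact inner_conj_symm _ _
  add_left f g h := by
    rw [← inner_toLp, ← inner_toLp, ← inner_toLp, map_add, inner_add_left]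
  smul_left f g c := by
    rw [← inner_toLp, ← inner_toLp, map_smul, inner_smul_left]

theorem inner_eq (f g : H2) : inner ℂ f g = ∑' n, conj (coeff f n) * coeff g n := rfl

/-- `toLp` as a linear isometry. -/
def toLpIso : H2 ≃ₗᵢ[ℂ] lp (fun _ : ℕ => ℂ) 2 := ⟨toLp, fun _ => rfl⟩

instance : CompleteSpace H2 := toLpIso.toIsometryEquiv.completeSpace

theorem summable_inner (f g : H2) : Summable fun n => conj (coeff f n) * coeff g n := by
  have h := lp.summable_inner (𝕜 := ℂ) (toLp f) (toLp g)
  simpa [toLp_apply, mul_comm] using h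

/-- The inner product is the boundary value of the integral means
`(2π)⁻¹ ∫₀^{2π} conj (f (r e^{iθ})) g (r e^{iθ}) dθ` as `r → 1⁻`. -/
theorem tendsto_circleAverage_inner (f g : H2) :
    Filter.Tendsto (fun r : ℝ => Real.circleAverage (fun z => conj (f z) * g z) 0 r)
      (nhdsWithin 1 (Set.Iio 1)) (nhds (inner ℂ f g)) := by
  have h : Filter.Tendsto
      (fun r : ℝ => ∑' n, conj (coeff f n) * coeff g n * ((r ^ (2 * n) : ℝ) : ℂ))
      (nhdsWithin 1 (Set.Iio 1)) (nhds (∑' n, conj (coeff f n) * coeff g n)) := by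
    refine tendsto_tsum_of_dominated_convergence (summable_inner f g).norm (fun n => ?_) ?_
    · have : Continuous fun r : ℝ => conj (coeff f n) * coeff g n * ((r ^ (2 * n) : ℝ) : ℂ) := by
        fun_prop
      have := (this.tendsto 1).mono_left (nhdsWithin_le_nhds (s := Set.Iio (1 : ℝ)))
      simpa using this
    · filter_upwards [Ioo_mem_nhdsLT (show (0 : ℝ) < 1 by norm_num)] with r hr n
      rw [norm_mul]
      refine mul_le_of_le_one_right (norm_nonneg _) ?_
      rw [norm_real, Real.norm_of_nonneg (pow_nonneg hr.1.le _)]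
      exact pow_le_one₀ hr.1.le hr.2.le
  refine h.congr' ?_
  filter_upwards [Ioo_mem_nhdsLT (show (0 : ℝ) < 1 by norm_num)] with r hr
  exact (avg_inner (rep_coeff f.diff) (rep_coeff g.diff) f.diff hr.1.le hr.2).tsum_eq

/-! ### Reproducing kernels -/

theorem summable_kernel {w : ℂ} (hw : w ∈ ball (0 : ℂ) 1) :
    Summable (fun n : ℕ => ‖conj w ^ n‖ ^ 2) := by
  have hw' : ‖w‖ < 1 := by simpa using hw
  have : (fun n : ℕ => ‖conj w ^ n‖ ^ 2) = fun n => (‖w‖ ^ 2) ^ n := by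
    funext n
    rw [norm_pow, RCLike.norm_conj, ← pow_mul, ← pow_mul, mul_comm]
  rw [this]
  exact summable_geometric_of_lt_one (by positivity) (pow_lt_one₀ (norm_nonneg _) hw' two_ne_zero)

/-- The kernel function `K_w(u) = (1 - conj w * u)⁻¹`. -/
def kernel (w : ball (0 : ℂ) 1) : H2 := ⟨ofCoeff fun n => conj (w : ℂ) ^ n,
  isHardy_ofCoeff (summable_kernel w.2)⟩

theorem rep_kernel (w : ball (0 : ℂ) 1) : Rep (fun n => conj (w : ℂ) ^ n) (kernel w) :=
  rep_ofCoeff (norm_le_of_summable (summable_kernel w.2))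

theorem norm_conj_mul_lt {w z : ℂ} (hw : w ∈ ball (0 : ℂ) 1) (hz : z ∈ ball (0 : ℂ) 1) :
    ‖conj w * z‖ < 1 := by
  have hw' : ‖w‖ < 1 := by simpa using hw
  have hz' : ‖z‖ < 1 := by simpa using hz
  rw [norm_mul, RCLike.norm_conj]
  exact mul_lt_one_of_nonneg_of_lt_one_left (norm_nonneg _) hw' hz'.le

theorem kernel_apply (w : ball (0 : ℂ) 1) {z : ℂ} (hz : z ∈ ball (0 : ℂ) 1) :
    kernel w z = (1 - conj (w : ℂ) * z)⁻¹ := by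
  refine (rep_kernel w z hz).unique ?_
  simp only [← mul_pow]
  exact hasSum_geometric_of_norm_lt_one (norm_conj_mul_lt w.2 hz)

theorem inner_kernel (w : ball (0 : ℂ) 1) (f : H2) : inner ℂ (kernel w) f = f w := by
  rw [inner_eq, coeff_eq (kernel w).diff (rep_kernel w)]
  refine Eq.trans ?_ (rep_coeff f.diff w w.2).tsum_eq
  simp [mul_comm]

theorem continuous_eval (w : ball (0 : ℂ) 1) : Continuous fun f : H2 => f w := by
  simp only [← inner_kernel]
  fun_prop

theorem denseRange_kernel : DenseRange (Finsupp.linearCombination ℂ kernel) := by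
  have h : (LinearMap.range (Finsupp.linearCombination ℂ kernel)).topologicalClosure = ⊤ := by
    rw [Submodule.topologicalClosure_eq_top_iff, Submodule.eq_bot_iff]
    intro f hf
    refine ext_fun fun z hz => ?_
    have := (Submodule.mem_orthogonal _ _).1 hf (kernel ⟨z, hz⟩)
      ⟨Finsupp.single ⟨z, hz⟩ 1, by simp⟩
    rw [inner_kernel] at this
    exact this
  have := Submodule.dense_iff_topologicalClosure_eq_top.2 h
  exact this

end H2

/-! ### The weighted composition conjugation -/

/-- The weight `κ(z) = √(1 - |λ|²) / (1 - z conj λ)`. -/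
def kappa (lam z : ℂ) : ℂ := (√(1 - ‖lam‖ ^ 2) : ℝ) / (1 - z * conj lam)

/-- The disc automorphism `φ(z) = (conj λ / λ) (λ - z) / (1 - z conj λ)`. -/
def phi (lam z : ℂ) : ℂ := conj lam / lam * ((lam - z) / (1 - z * conj lam))

/-- The function `z ↦ β κ(z) conj (f (conj (φ z)))` on the unit disc. -/
def jFun (β lam : ℂ) (f : ℂ → ℂ) : ℂ → ℂ :=
  (ball 0 1).indicator fun z => β * kappa lam z * conj (f (conj (phi lam z)))

section Mobius

variable {β lam : ℂ}

theorem den_ne {lam : ℂ} (h1 : ‖lam‖ < 1) {z : ℂ} (hz : z ∈ ball (0 : ℂ) 1) :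
    1 - z * conj lam ≠ 0 := by
  intro h
  have h2 := H2.norm_conj_mul_lt (w := lam) (by simpa using h1) hz
  rw [mul_comm, ← sub_eq_zero.1 h] at h2
  simp at h2

theorem den_ne' {lam : ℂ} (h1 : ‖lam‖ < 1) {z : ℂ} (hz : z ∈ ball (0 : ℂ) 1) :
    1 - conj z * lam ≠ 0 := by
  have := (map_ne_zero (starRingEnd ℂ)).2 (den_ne h1 hz)
  simpa using this

theorem one_sub_ne {z w : ℂ} (hz : z ∈ ball (0 : ℂ) 1) (hw : w ∈ ball (0 : ℂ) 1) :
    1 - z * w ≠ 0 := by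
  have := den_ne (lam := conj w) (by simpa using hw) hz
  simpa using this

theorem conj_mem {z : ℂ} (hz : z ∈ ball (0 : ℂ) 1) : conj z ∈ ball (0 : ℂ) 1 := by
  simpa using hz

theorem sqrt_mul_self (h1 : ‖lam‖ < 1) :
    ((√(1 - ‖lam‖ ^ 2) : ℝ) : ℂ) * ((√(1 - ‖lam‖ ^ 2) : ℝ) : ℂ) = 1 - lam * conj lam := by
  have : 0 ≤ 1 - ‖lam‖ ^ 2 := by nlinarith [norm_nonneg lam]
  rw [← ofReal_mul, Real.mul_self_sqrt this, mul_conj']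
  push_cast
  rfl

theorem phi_identity (h0 : lam ≠ 0) (h1 : ‖lam‖ < 1) {v w : ℂ} (hv : v ∈ ball (0 : ℂ) 1)
    (hw : w ∈ ball (0 : ℂ) 1) :
    1 - phi lam v * conj (phi lam w) = kappa lam v * conj (kappa lam w) * (1 - v * conj w) := by
  have d1 := den_ne h1 hv
  have d2 := den_ne' h1 hw
  have c0 : conj lam ≠ 0 := (map_ne_zero _).2 h0
  have e : kappa lam v * conj (kappa lam w)
      = (1 - lam * conj lam) / ((1 - v * conj lam) * (1 - conj w * lam)) := by
    rw [← sqrt_mul_self h1]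
    simp only [kappa, map_div₀, conj_ofReal, map_sub, map_mul, map_one, conj_conj]
    rw [div_mul_div_comm]
  rw [e]
  simp only [phi, map_div₀, map_sub, map_mul, map_one, conj_conj]
  generalize hD : 1 - v * conj lam = D at *
  generalize hD' : 1 - conj w * lam = D' at *
  field_simp
  rw [← hD, ← hD']
  ring

theorem phi_mem (h0 : lam ≠ 0) (h1 : ‖lam‖ < 1) {z : ℂ} (hz : z ∈ ball (0 : ℂ) 1) :
    phi lam z ∈ ball (0 : ℂ) 1 := by
  have h := phi_identity h0 h1 hz hz
  rw [mul_conj', mul_conj', mul_conj'] at h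
  have h' : 1 - ‖phi lam z‖ ^ 2 = ‖kappa lam z‖ ^ 2 * (1 - ‖z‖ ^ 2) := by exact_mod_cast h
  have hz' : ‖z‖ < 1 := by simpa using hz
  have hk : kappa lam z ≠ 0 := by
    refine div_ne_zero ?_ (den_ne h1 hz)
    have : 0 < 1 - ‖lam‖ ^ 2 := by nlinarith [norm_nonneg lam]
    exact_mod_cast (Real.sqrt_pos.2 this).ne'
  have : 0 < ‖kappa lam z‖ ^ 2 * (1 - ‖z‖ ^ 2) := by
    refine mul_pos (by positivity) ?_
    nlinarith [norm_nonneg z]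
  rw [← h'] at this
  rw [mem_ball_zero_iff]
  nlinarith [norm_nonneg (phi lam z)]

theorem phi_symm (h0 : lam ≠ 0) (h1 : ‖lam‖ < 1) {z w : ℂ} (hz : z ∈ ball (0 : ℂ) 1)
    (hw : w ∈ ball (0 : ℂ) 1) :
    kappa lam z * (1 - w * phi lam z)⁻¹ = kappa lam w * (1 - phi lam w * z)⁻¹ := by
  have d1 := den_ne h1 hz
  have d2 := den_ne h1 hw
  have n1 := one_sub_ne hw (phi_mem h0 h1 hz)
  have n2 := one_sub_ne (phi_mem h0 h1 hw) hz
  have e : (1 - phi lam w * z) * (1 - w * conj lam) = (1 - w * phi lam z) * (1 - z * conj lam) := by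
    simp only [phi]
    clear n1 n2
    generalize hD : 1 - z * conj lam = D at *
    generalize hD' : 1 - w * conj lam = D' at *
    field_simp
    rw [← hD, ← hD']
    ring
  simp only [kappa, ← div_eq_mul_inv, div_div]
  rw [mul_comm (1 - w * conj lam), e, mul_comm (1 - z * conj lam)]

theorem phi_conj_phi (h0 : lam ≠ 0) (h1 : ‖lam‖ < 1) {z : ℂ} (hz : z ∈ ball (0 : ℂ) 1) :
    conj (phi lam (conj (phi lam z))) = z := by
  have d1 := den_ne h1 hz
  have d3 := den_ne h1 (conj_mem (phi_mem h0 h1 hz))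
  have d3' := (map_ne_zero (starRingEnd ℂ)).2 d3
  have c0 : conj lam ≠ 0 := (map_ne_zero _).2 h0
  have e : conj (phi lam (conj (phi lam z)))
      = lam / conj lam * ((conj lam - phi lam z) / (1 - phi lam z * lam)) := by
    rw [phi.eq_def lam (conj (phi lam z))]
    simp
  have d4 : 1 - phi lam z * lam ≠ 0 := by simpa using d3'
  rw [e, mul_div_assoc', div_eq_iff d4, div_mul_eq_mul_div, div_eq_iff c0]
  clear e d3 d3' d4
  simp only [phi]
  generalize hD : 1 - z * conj lam = D at *
  field_simp
  rw [← hD]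
  ring

theorem kappa_mul (h0 : lam ≠ 0) (h1 : ‖lam‖ < 1) {z : ℂ} (hz : z ∈ ball (0 : ℂ) 1) :
    kappa lam z * conj (kappa lam (conj (phi lam z))) = 1 := by
  have d1 := den_ne h1 hz
  have d3' := (map_ne_zero (starRingEnd ℂ)).2 (den_ne h1 (conj_mem (phi_mem h0 h1 hz)))
  have d4 : 1 - phi lam z * lam ≠ 0 := by simpa using d3'
  have e : kappa lam z * conj (kappa lam (conj (phi lam z)))
      = (1 - lam * conj lam) / ((1 - z * conj lam) * (1 - phi lam z * lam)) := by
    rw [← sqrt_mul_self h1]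
    simp only [kappa, map_div₀, conj_ofReal, map_sub, map_mul, map_one, conj_conj]
    rw [div_mul_div_comm]
  rw [e, div_eq_one_iff_eq (mul_ne_zero d1 d4)]
  clear e d3' d4
  simp only [phi]
  generalize hD : 1 - z * conj lam = D at *
  field_simp
  rw [← hD]
  ring

/-- The point `conj (φ w)` of the disc. -/
def phiPt (h0 : lam ≠ 0) (h1 : ‖lam‖ < 1) (w : ball (0 : ℂ) 1) : ball (0 : ℂ) 1 :=
  ⟨conj (phi lam w), conj_mem (phi_mem h0 h1 w.2)⟩

/-- The antilinear map on finite combinations of points sending `w` to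
`β κ(w) K_{conj (φ w)}`. -/
def jPre (β : ℂ) (h0 : lam ≠ 0) (h1 : ‖lam‖ < 1) : (ball (0 : ℂ) 1 →₀ ℂ) →ₗ⋆[ℂ] H2 where
  toFun c := c.sum fun w a => conj a • (β * kappa lam w) • H2.kernel (phiPt h0 h1 w)
  map_add' c d := Finsupp.sum_add_index' (by simp) (by simp [add_smul])
  map_smul' t c := by
    rw [Finsupp.sum_smul_index' (by simp), Finsupp.smul_sum]
    simp [mul_smul]

theorem norm_jPre (hβ : ‖β‖ = 1) (h0 : lam ≠ 0) (h1 : ‖lam‖ < 1) (c : ball (0 : ℂ) 1 →₀ ℂ) :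
    ‖jPre β h0 h1 c‖ = ‖Finsupp.linearCombination ℂ H2.kernel c‖ := by
  have hb : conj β * β = 1 := by rw [conj_mul', hβ]; simp
  have gram : ∀ v w : ball (0 : ℂ) 1,
      inner ℂ ((β * kappa lam w) • H2.kernel (phiPt h0 h1 w))
        ((β * kappa lam v) • H2.kernel (phiPt h0 h1 v))
      = inner ℂ (H2.kernel v) (H2.kernel w) := by
    intro v w
    rw [inner_smul_left, inner_smul_right, H2.inner_kernel, H2.inner_kernel,
      H2.kernel_apply _ (phiPt h0 h1 w).2, H2.kernel_apply _ v.2]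
    have id := phi_identity h0 h1 v.2 w.2
    have n1 := one_sub_ne (phi_mem h0 h1 v.2) (conj_mem (phi_mem h0 h1 w.2))
    have n2 := one_sub_ne v.2 (conj_mem w.2)
    simp only [phiPt, conj_conj, map_mul]
    rw [mul_comm (conj (w : ℂ))]
    have hb' : conj β * conj (kappa lam w) * (β * kappa lam v * (1 - phi lam v * conj (phi lam w))⁻¹)
        = (conj β * β) * ((kappa lam v * conj (kappa lam w))
          * (1 - phi lam v * conj (phi lam w))⁻¹) := by ring
    rw [hb', hb, one_mul, ← div_eq_mul_inv, div_eq_iff n1, id]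
    field_simp
  have key : inner ℂ (jPre β h0 h1 c) (jPre β h0 h1 c)
      = inner ℂ (Finsupp.linearCombination ℂ H2.kernel c)
          (Finsupp.linearCombination ℂ H2.kernel c) := by
    change inner ℂ (c.sum fun w a => conj a • (β * kappa lam w) • H2.kernel (phiPt h0 h1 w))
        (c.sum fun w a => conj a • (β * kappa lam w) • H2.kernel (phiPt h0 h1 w)) = _
    rw [Finsupp.linearCombination_apply]
    simp only [Finsupp.sum, sum_inner, inner_sum]
    rw [Finset.sum_comm]
    refine Finset.sum_congr rfl fun v _ => Finset.sum_congr rfl fun w _ => ?_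
    rw [inner_smul_left, inner_smul_right, gram, inner_smul_left, inner_smul_right, conj_conj]
    ring
  rw [inner_self_eq_norm_sq_to_K, inner_self_eq_norm_sq_to_K] at key
  have key' : ‖jPre β h0 h1 c‖ ^ 2 = ‖Finsupp.linearCombination ℂ H2.kernel c‖ ^ 2 := by
    exact_mod_cast key
  exact (pow_left_inj₀ (norm_nonneg _) (norm_nonneg _) two_ne_zero).1 key'

/-- The weighted composition formula agrees with the antilinear contraction that is determined by
its values on the kernel functions. -/
theorem exists_jExt (hβ : ‖β‖ = 1) (h0 : lam ≠ 0) (h1 : ‖lam‖ < 1) (f : H2) :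
    ∃ g : H2, (g : ℂ → ℂ) = jFun β lam f ∧ ‖g‖ ≤ ‖f‖ := by
  set e := Finsupp.linearCombination ℂ H2.kernel
  set T : H2 →SL[starRingEnd ℂ] H2 := (jPre β h0 h1).extendOfNorm e
  have hn : ∀ c, ‖jPre β h0 h1 c‖ ≤ 1 * ‖e c‖ := fun c => by rw [norm_jPre hβ, one_mul]
  have hT : ∀ c, T (e c) = jPre β h0 h1 c :=
    LinearMap.extendOfNorm_eq H2.denseRange_kernel ⟨1, hn⟩
  refine ⟨T f, ?_, ?_⟩
  · funext z
    by_cases hz : z ∈ ball (0 : ℂ) 1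
    swap
    · rw [(T f).2.2.2 z hz, jFun, Set.indicator_of_notMem hz]
    rw [jFun, Set.indicator_of_mem hz]
    refine H2.denseRange_kernel.induction_on
      (p := fun f : H2 => (T f) z = β * kappa lam z * conj (f (conj (phi lam z)))) f ?_ ?_
    · refine isClosed_eq ((H2.continuous_eval ⟨z, hz⟩).comp T.continuous) ?_
      exact continuous_const.mul (continuous_conj.comp (H2.continuous_eval (phiPt h0 h1 ⟨z, hz⟩)))
    · intro c
      change (T (e c)) z = β * kappa lam z * conj ((e c) (conj (phi lam z)))
      rw [hT]
      induction c using Finsupp.induction_linear with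
      | zero =>
        simp only [map_zero]
        change (0 : ℂ) = _ * conj (0 : ℂ)
        simp
      | add c d hc hd =>
        simp only [map_add, H2.coe_add, Pi.add_apply, hc, hd, mul_add]
      | single w a =>
        have e1 : jPre β h0 h1 (Finsupp.single w a)
            = conj a • (β * kappa lam w) • H2.kernel (phiPt h0 h1 w) :=
          Finsupp.sum_single_index
            (h := fun (w : ball (0 : ℂ) 1) (a : ℂ) =>
              conj a • (β * kappa lam w) • H2.kernel (phiPt h0 h1 w)) (by simp)
        rw [e1, Finsupp.linearCombination_single]
        simp only [H2.coe_smul, Pi.smul_apply, smul_eq_mul]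
        rw [H2.kernel_apply _ hz, H2.kernel_apply _ (conj_mem (phi_mem h0 h1 hz))]
        have hs := phi_symm h0 h1 hz w.2
        simp only [phiPt, conj_conj, map_mul, map_inv₀, map_sub, map_one]
        linear_combination (-(conj a * β)) * hs
  · simpa using LinearMap.norm_extendOfNorm_apply_le H2.denseRange_kernel 1 hn f

theorem isHardy_jFun (hβ : ‖β‖ = 1) (h0 : lam ≠ 0) (h1 : ‖lam‖ < 1) (f : H2) :
    IsHardy (jFun β lam f) := by
  obtain ⟨g, hg, -⟩ := exists_jExt hβ h0 h1 f
  rw [← hg]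
  exact g.2

theorem jFun_jFun (hβ : ‖β‖ = 1) (h0 : lam ≠ 0) (h1 : ‖lam‖ < 1) {f : ℂ → ℂ} {z : ℂ}
    (hz : z ∈ ball (0 : ℂ) 1) : jFun β lam (jFun β lam f) z = f z := by
  have hb : β * conj β = 1 := by rw [mul_conj', hβ]; simp
  have hz' := conj_mem (phi_mem h0 h1 hz)
  rw [jFun, Set.indicator_of_mem hz, jFun, Set.indicator_of_mem hz', phi_conj_phi h0 h1 hz]
  simp only [map_mul, conj_conj]
  linear_combination f z * (conj β * β) * kappa_mul h0 h1 hz + f z * hb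

end Mobius

end Hardy

/-! ### Conjugations and complex selfadjointness -/

section Abstract

variable {E : Type*} [NormedAddCommGroup E] [InnerProductSpace ℂ E]

/-- A conjugation on a complex inner product space: an antilinear isometric involution. -/
structure Conjugation (E : Type*) [NormedAddCommGroup E] [InnerProductSpace ℂ E]
    extends E →ₗᵢ⋆[ℂ] E where
  involutive' : Function.Involutive toFun

/-- The operator `C T C`, with its natural domain `{x | C x ∈ dom T}`. -/
def Conjugation.conjugate (C : Conjugation E) (T : E →ₗ.[ℂ] E) : E →ₗ.[ℂ] E where
  domain := T.domain.comap C.toLinearMap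
  toFun :=
    { toFun := fun x => C.toLinearMap (T ⟨C.toLinearMap x, x.2⟩)
      map_add' := fun x y => by
        rw [← map_add, ← T.map_add]
        congr 2
        exact Subtype.ext (map_add C.toLinearMap (x : E) y)
      map_smul' := fun a x => by
        have h : (⟨C.toLinearMap (a • x : T.domain.comap C.toLinearMap),
            (a • x : T.domain.comap C.toLinearMap).2⟩ : T.domain)
            = (starRingEnd ℂ a) • ⟨C.toLinearMap x, x.2⟩ :=
          Subtype.ext (LinearMap.map_smulₛₗ C.toLinearMap a (x : E))
        rw [h, T.map_smul, LinearMap.map_smulₛₗ]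
        simp }

/-- `T` is `C`-selfadjoint: it is densely defined and `T = C T* C`. -/
def IsCSelfAdjoint [CompleteSpace E] (C : Conjugation E) (T : E →ₗ.[ℂ] E) : Prop :=
  Dense (T.domain : Set E) ∧ T = C.conjugate T.adjoint

end Abstract

namespace Hardy

/-- The weighted composition conjugation `J_{β,λ}` on `H²`:
`J f (z) = β κ(z) conj (f (conj (φ z)))`. -/
def conjJ (β lam : ℂ) (hβ : ‖β‖ = 1) (h0 : lam ≠ 0) (h1 : ‖lam‖ < 1) : Conjugation H2 :=
  let J : H2 →ₗ⋆[ℂ] H2 :=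
    { toFun := fun f => ⟨jFun β lam f, isHardy_jFun hβ h0 h1 f⟩
      map_add' := fun f g => H2.ext_fun fun z hz => by
        change jFun β lam (f + g : H2) z = jFun β lam f z + jFun β lam g z
        simp only [H2.coe_add, jFun, Set.indicator_of_mem hz, Pi.add_apply, map_add, mul_add]
      map_smul' := fun c f => H2.ext_fun fun z hz => by
        change jFun β lam (c • f : H2) z = conj c * jFun β lam f z
        simp only [H2.coe_smul, jFun, Set.indicator_of_mem hz, Pi.smul_apply, smul_eq_mul, map_mul]
        ring }
  have hinv : ∀ f, J (J f) = f := fun f => H2.ext_fun fun _ hz => jFun_jFun hβ h0 h1 hz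
  have hle : ∀ f, ‖J f‖ ≤ ‖f‖ := fun f => by
    obtain ⟨g, hg, hle⟩ := exists_jExt hβ h0 h1 f
    rwa [show J f = g from Subtype.ext hg.symm]
  { J with
    norm_map' := fun f => le_antisymm (hle f) (by simpa only [hinv] using hle (J f))
    involutive' := hinv }

/-! ### The maximal first-order differential operator -/

/-- The differential expression `E(ψ₀, ψ₁) f = ψ₀ f + ψ₁ f'` on the unit disc (extended by zero). -/
def diffExpr (ψ₀ ψ₁ f : ℂ → ℂ) : ℂ → ℂ :=
  (ball 0 1).indicator fun z => ψ₀ z * f z + ψ₁ z * deriv f z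

theorem diffExpr_add (ψ₀ ψ₁ : ℂ → ℂ) (f g : H2) :
    diffExpr ψ₀ ψ₁ (f + g : H2) = diffExpr ψ₀ ψ₁ f + diffExpr ψ₀ ψ₁ g := by
  funext z
  by_cases hz : z ∈ ball (0 : ℂ) 1
  · have hf := f.diff.differentiableAt (isOpen_ball.mem_nhds hz)
    have hg := g.diff.differentiableAt (isOpen_ball.mem_nhds hz)
    simp only [diffExpr, Pi.add_apply, Set.indicator_of_mem hz, H2.coe_add, deriv_add hf hg]
    ring
  · simp [diffExpr, Set.indicator_of_notMem hz]

theorem diffExpr_smul (ψ₀ ψ₁ : ℂ → ℂ) (c : ℂ) (f : H2) :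
    diffExpr ψ₀ ψ₁ (c • f : H2) = c • diffExpr ψ₀ ψ₁ f := by
  funext z
  by_cases hz : z ∈ ball (0 : ℂ) 1
  · have hf := f.diff.differentiableAt (isOpen_ball.mem_nhds hz)
    simp only [diffExpr, Pi.smul_apply, Set.indicator_of_mem hz, H2.coe_smul, deriv_const_smul c hf,
      smul_eq_mul]
    ring
  · simp [diffExpr, Set.indicator_of_notMem hz]

/-- The maximal differential operator: `f ↦ ψ₀ f + ψ₁ f'` on the domain of all `f ∈ H²` for which
`ψ₀ f + ψ₁ f'` belongs to `H²`. -/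
def maxOp (ψ₀ ψ₁ : ℂ → ℂ) : H2 →ₗ.[ℂ] H2 where
  domain :=
    { carrier := {f | IsHardy (diffExpr ψ₀ ψ₁ f)}
      zero_mem' := by
        have h := diffExpr_smul ψ₀ ψ₁ 0 0
        rw [zero_smul, zero_smul] at h
        change IsHardy (diffExpr ψ₀ ψ₁ (0 : H2))
        rw [h]
        exact hardySubmodule.zero_mem
      add_mem' := fun {f g} hf hg => by
        change IsHardy (diffExpr ψ₀ ψ₁ (f + g : H2))
        rw [diffExpr_add]
        exact hardySubmodule.add_mem hf hg
      smul_mem' := fun c f hf => by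
        change IsHardy (diffExpr ψ₀ ψ₁ (c • f : H2))
        rw [diffExpr_smul]
        exact hardySubmodule.smul_mem c hf }
  toFun :=
    { toFun := fun f => ⟨diffExpr ψ₀ ψ₁ f.1, f.2⟩
      map_add' := fun f g => Subtype.ext (diffExpr_add ψ₀ ψ₁ f.1 g.1)
      map_smul' := fun c f => Subtype.ext (diffExpr_smul ψ₀ ψ₁ c f.1) }

end Hardy

end

/-!
Write `E` for the maximal operator and `J` for the conjugation.  Evaluation of `E f` at a point `w`
is a bounded functional on `H²`, represented by `exprKernel ψ₀ ψ₁ w`, so `E* K_w` is this element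
for every kernel function `K_w`.  Hence the inclusion `E* ≤ J E J` forces `E J K_w = J E* K_w`.
Since `J K_w` is a multiple of another kernel function, this is an explicit functional equation
between the values of `ψ₀` and `ψ₁` at two points (`diffExpr_conjJ_kernel_iff`); evaluating it at
`λ` and at `0` gives the asserted polynomials (`exists_coeffs_of_symmAt`).

Conversely, these polynomials satisfy the functional equation, so `E J K_w = J E* K_w` holds.
Testing the adjoint relation on the functions `J K_w`, whose span is dense, gives `E* ≤ J E J`.
The remaining inclusion `J E J ≤ E*` is a symmetry of `E` on its whole maximal domain,
`⟪J g, E f⟫ = ⟪J (E g), f⟫` (`inner_conjJ_maxOp`).  It is clear when `f` is a kernel function.  The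
general case is by dilation, `f_r = f (r ·)`: for `r < 1` the map `f ↦ E f_r` is bounded and
dilations map kernel functions to kernel functions, so the identity holds for every `f_r`.  As
`r → 1`, `E f_r → E f` in `H²` (`tendsto_maxOp_dil`), because the commutator of `E` with the
dilation involves only `(1 - r) f_r` and `(1 - r) f' (r ·)`.  The latter tends to `0` in `H²` since
its coefficient multipliers `(1 - r) (n + 1) r ^ n` are at most `1` and tend to `0` for each `n`.
-/

namespace Hardy

namespace H2

/-! ### Bounded operators given by their action on Taylor coefficients -/

theorem norm_sq_eq_tsum (f : H2) : ‖f‖ ^ 2 = ∑' n, ‖coeff f n‖ ^ 2 := by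
  have h := inner_self_eq_norm_sq_to_K (𝕜 := ℂ) f
  rw [inner_eq] at h
  have e : (fun n => conj (coeff f n) * coeff f n) = fun n => ((‖coeff f n‖ ^ 2 : ℝ) : ℂ) := by
    funext n
    rw [conj_mul', ofReal_pow]
  rw [e, ← ofReal_tsum] at h
  exact ofReal_injective (by simpa using h.symm)

theorem ext_coeff {f g : H2} (h : ∀ n, coeff f n = coeff g n) : f = g :=
  toLp.injective (Subtype.ext (funext h))

/-- The element of `H²` with a prescribed square summable sequence of Taylor coefficients. -/
noncomputable def ofSeq (a : ℕ → ℂ) (ha : Summable fun n => ‖a n‖ ^ 2) : H2 :=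
  ⟨ofCoeff a, isHardy_ofCoeff ha⟩

theorem coeff_ofSeq (a : ℕ → ℂ) (ha : Summable fun n => ‖a n‖ ^ 2) (n : ℕ) :
    coeff (ofSeq a ha) n = a n :=
  congrFun (coeff_eq (ofSeq a ha).diff (rep_ofCoeff (norm_le_of_summable ha))) n

theorem coeff_add (f g : H2) (n : ℕ) : coeff (f + g : H2) n = coeff f n + coeff g n :=
  congrFun (congrArg Subtype.val (toLp.map_add f g)) n

theorem coeff_smul (c : ℂ) (f : H2) (n : ℕ) : coeff (c • f : H2) n = c * coeff f n :=
  congrFun (congrArg Subtype.val (toLp.map_smul c f)) n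

/-- A linear action on coefficient sequences that is bounded in `ℓ²` norm defines a bounded
operator on `H²`. -/
noncomputable def ofCoeffMap (A : (ℕ → ℂ) →ₗ[ℂ] (ℕ → ℂ)) (C : ℝ) (hC : 0 ≤ C)
    (hA : ∀ f : H2, Summable (fun n => ‖A (coeff f) n‖ ^ 2) ∧
      ∑' n, ‖A (coeff f) n‖ ^ 2 ≤ C ^ 2 * ∑' n, ‖coeff f n‖ ^ 2) : H2 →L[ℂ] H2 :=
  LinearMap.mkContinuous
    { toFun := fun f => ofSeq (A (coeff f)) (hA f).1
      map_add' := fun f g => ext_coeff fun n => by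
        rw [coeff_add, coeff_ofSeq, coeff_ofSeq, coeff_ofSeq,
          show coeff (f + g : H2) = coeff f + coeff g from funext (coeff_add f g), map_add,
          Pi.add_apply]
      map_smul' := fun c f => ext_coeff fun n => by
        rw [RingHom.id_apply, coeff_smul, coeff_ofSeq, coeff_ofSeq,
          show coeff (c • f : H2) = c • coeff f from funext (coeff_smul c f), map_smul,
          Pi.smul_apply, smul_eq_mul] }
    C fun f => by
      refine le_of_sq_le_sq ?_ (mul_nonneg hC (norm_nonneg f))
      rw [mul_pow, norm_sq_eq_tsum, norm_sq_eq_tsum f]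
      simpa only [LinearMap.coe_mk, AddHom.coe_mk, coeff_ofSeq] using (hA f).2

theorem coeff_ofCoeffMap {A : (ℕ → ℂ) →ₗ[ℂ] (ℕ → ℂ)} {C : ℝ} {hC : 0 ≤ C}
    {hA : ∀ f : H2, Summable (fun n => ‖A (coeff f) n‖ ^ 2) ∧
      ∑' n, ‖A (coeff f) n‖ ^ 2 ≤ C ^ 2 * ∑' n, ‖coeff f n‖ ^ 2} (f : H2) (n : ℕ) :
    coeff (ofCoeffMap A C hC hA f) n = A (coeff f) n :=
  coeff_ofSeq _ (hA f).1 n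

/-- The operator multiplying the `n`-th Taylor coefficient by `m n`, where `‖m n‖ ≤ 1`. -/
noncomputable def diag (m : ℕ → ℂ) (hm : ∀ n, ‖m n‖ ≤ 1) : H2 →L[ℂ] H2 :=
  ofCoeffMap (LinearMap.mulLeft ℂ m) 1 zero_le_one fun f => by
    have h : ∀ n, ‖m n * coeff f n‖ ^ 2 ≤ ‖coeff f n‖ ^ 2 := fun n => by
      rw [norm_mul]
      gcongr
      exact mul_le_of_le_one_left (norm_nonneg _) (hm n)
    have hs := summable_sq_of_isHardy f.2
    have hs' : Summable fun n => ‖m n * coeff f n‖ ^ 2 :=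
      Summable.of_nonneg_of_le (fun n => by positivity) h hs
    exact ⟨hs', by simpa using hs'.tsum_le_tsum h hs⟩

theorem coeff_diag {m : ℕ → ℂ} (hm : ∀ n, ‖m n‖ ≤ 1) (f : H2) (n : ℕ) :
    coeff (diag m hm f) n = m n * coeff f n :=
  coeff_ofCoeffMap f n

/-- The backward shift of Taylor coefficients. -/
noncomputable def backShift : H2 →L[ℂ] H2 :=
  ofCoeffMap (LinearMap.funLeft ℂ ℂ Nat.succ) 1 zero_le_one fun f => by
    have hs := summable_sq_of_isHardy f.2
    refine ⟨(summable_nat_add_iff 1).2 hs, ?_⟩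
    rw [hs.tsum_eq_zero_add]
    simp [LinearMap.funLeft_apply]

theorem coeff_backShift (f : H2) (n : ℕ) : coeff (backShift f) n = coeff f (n + 1) :=
  coeff_ofCoeffMap f n

/-- Multiplication by the coordinate function: the forward shift of Taylor coefficients. -/
noncomputable def shift : H2 →L[ℂ] H2 :=
  ofCoeffMap
    { toFun := fun a n => n.casesOn 0 a
      map_add' := fun a b => by funext n; cases n <;> simp
      map_smul' := fun c a => by funext n; cases n <;> simp } 1 zero_le_one fun f => by
    have hs := summable_sq_of_isHardy f.2
    have hs' : Summable fun n : ℕ => ‖(n.casesOn 0 (coeff f) : ℂ)‖ ^ 2 :=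
      (summable_nat_add_iff 1).1 hs
    refine ⟨hs', ?_⟩
    change ∑' n : ℕ, ‖(n.casesOn 0 (coeff f) : ℂ)‖ ^ 2 ≤ _
    rw [hs'.tsum_eq_zero_add]
    simp

theorem shift_apply (f : H2) {z : ℂ} (hz : z ∈ ball (0 : ℂ) 1) : shift f z = z * f z := by
  have h1 := rep_coeff (shift f).diff z hz
  have h2 := (rep_coeff f.diff z hz).mul_left z
  rw [← hasSum_nat_add_iff' 1] at h1
  have e0 : coeff (shift f) 0 = 0 := coeff_ofCoeffMap f 0
  have e1 : ∀ n, coeff (shift f) (n + 1) = coeff f n := fun n => coeff_ofCoeffMap f (n + 1)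
  simp only [Finset.sum_range_one, e0, e1, zero_mul, sub_zero] at h1
  refine h1.unique ?_
  rw [show (fun n => coeff f n * z ^ (n + 1)) = fun n => z * (coeff f n * z ^ n) from
    funext fun n => by ring]
  exact h2

/-- Coefficient multipliers that are uniformly bounded and tend to `0` coefficientwise tend to `0`
strongly. -/
theorem tendsto_diag_zero {m : ℕ → ℕ → ℂ} (hm : ∀ j n, ‖m j n‖ ≤ 1)
    (h : ∀ n, Filter.Tendsto (fun j => m j n) Filter.atTop (nhds 0)) (f : H2) :
    Filter.Tendsto (fun j => diag (m j) (hm j) f) Filter.atTop (nhds 0) := by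
  have hs := summable_sq_of_isHardy f.2
  have key : Filter.Tendsto (fun j => ∑' n, ‖m j n * coeff f n‖ ^ 2) Filter.atTop
      (nhds (∑' _ : ℕ, (0 : ℝ))) := by
    refine tendsto_tsum_of_dominated_convergence hs (fun n => ?_)
      (Filter.Eventually.of_forall fun j n => ?_)
    · simpa using (((h n).mul_const (coeff f n)).norm.pow 2)
    · rw [norm_pow, norm_norm, norm_mul]
      gcongr
      exact mul_le_of_le_one_left (norm_nonneg _) (hm j n)
  rw [tendsto_zero_iff_norm_tendsto_zero]
  have e : ∀ j, ‖diag (m j) (hm j) f‖ = √(∑' n, ‖m j n * coeff f n‖ ^ 2) := fun j => by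
    rw [← Real.sqrt_sq (norm_nonneg (diag (m j) (hm j) f)), norm_sq_eq_tsum]
    simp only [coeff_diag]
  simp only [e]
  simpa using key.sqrt

/-! ### Dilations -/

theorem norm_real_pow_le {r : ℝ} (h0 : 0 ≤ r) (h1 : r < 1) (n : ℕ) : ‖(r : ℂ) ^ n‖ ≤ 1 := by
  rw [norm_pow, norm_real, Real.norm_of_nonneg h0]
  exact pow_le_one₀ h0 h1.le

/-- The dilation `f ↦ f (r ·)`. -/
noncomputable def dil (r : ℝ) (h0 : 0 ≤ r) (h1 : r < 1) : H2 →L[ℂ] H2 :=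
  diag (fun n => (r : ℂ) ^ n) (norm_real_pow_le h0 h1)

theorem mul_mem_ball {r : ℝ} (h0 : 0 ≤ r) (h1 : r < 1) {z : ℂ} (hz : z ∈ ball (0 : ℂ) 1) :
    (r : ℂ) * z ∈ ball (0 : ℂ) 1 := by
  rw [mem_ball_zero_iff] at *
  rw [norm_mul, norm_real, Real.norm_of_nonneg h0]
  exact mul_lt_one_of_nonneg_of_lt_one_left h0 h1 hz.le

theorem dil_apply {r : ℝ} (h0 : 0 ≤ r) (h1 : r < 1) (f : H2) {z : ℂ} (hz : z ∈ ball (0 : ℂ) 1) :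
    dil r h0 h1 f z = f (r * z) := by
  refine (rep_coeff (dil r h0 h1 f).diff z hz).unique ?_
  convert rep_coeff f.diff _ (mul_mem_ball h0 h1 hz) using 2 with n
  rw [dil, coeff_diag]
  ring

theorem deriv_dil {r : ℝ} (h0 : 0 ≤ r) (h1 : r < 1) (f : H2) {z : ℂ} (hz : z ∈ ball (0 : ℂ) 1) :
    deriv (dil r h0 h1 f) z = r * deriv f (r * z) := by
  have e : (dil r h0 h1 f : ℂ → ℂ) =ᶠ[nhds z] fun z => f (r * z) := by
    filter_upwards [isOpen_ball.mem_nhds hz] with w hw using dil_apply h0 h1 f hw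
  have hd := (f.diff.differentiableAt
    (isOpen_ball.mem_nhds (mul_mem_ball h0 h1 hz))).hasDerivAt
  have := hd.comp z ((hasDerivAt_id z).const_mul (r : ℂ))
  rw [e.deriv_eq]
  rw [mul_comm]
  simpa using! this.deriv

theorem dil_kernel {r : ℝ} (h0 : 0 ≤ r) (h1 : r < 1) (w : ball (0 : ℂ) 1) :
    dil r h0 h1 (kernel w) = kernel ⟨r * w, mul_mem_ball h0 h1 w.2⟩ := by
  refine ext_fun fun z hz => ?_
  rw [dil_apply h0 h1 _ hz, kernel_apply _ (mul_mem_ball h0 h1 hz), kernel_apply _ hz]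
  simp only [map_mul, conj_ofReal]
  ring_nf

theorem one_sub_mul_pow_le {r : ℝ} (h0 : 0 ≤ r) (h1 : r < 1) (n : ℕ) :
    (1 - r) * ((n + 1) * r ^ n) ≤ 1 - r ^ (n + 1) := by
  induction n with
  | zero => simp
  | succ n ih =>
    have h2 := pow_le_one₀ h0 h1.le (n := n + 1)
    push_cast
    have e : (1 - r) * (((n : ℝ) + 1 + 1) * r ^ (n + 1))
        = r * ((1 - r) * ((n + 1) * r ^ n)) + (r ^ (n + 1) - r * r ^ (n + 1)) := by ring
    rw [e, pow_succ r (n + 1)]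
    nlinarith [mul_le_mul_of_nonneg_left ih h0, mul_nonneg (sub_nonneg.2 h1.le) (sub_nonneg.2 h2)]

theorem norm_derivWeight_le {r : ℝ} (h0 : 0 ≤ r) (h1 : r < 1) (n : ℕ) :
    ‖(((1 - r) * ((n + 1) * r ^ n) : ℝ) : ℂ)‖ ≤ 1 := by
  have := sub_nonneg.2 h1.le
  rw [norm_real, Real.norm_of_nonneg (by positivity)]
  have h2 := one_sub_mul_pow_le h0 h1 n
  have : 0 ≤ r ^ (n + 1) := by positivity
  linarith

/-- The operator `f ↦ (1 - r) f' (r ·)`.  With the factor `1 - r` it is a contraction. -/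
noncomputable def dilDeriv (r : ℝ) (h0 : 0 ≤ r) (h1 : r < 1) : H2 →L[ℂ] H2 :=
  (diag (fun n => (((1 - r) * ((n + 1) * r ^ n) : ℝ) : ℂ)) (norm_derivWeight_le h0 h1)).comp
    backShift

theorem coeff_deriv (f : ℂ → ℂ) (n : ℕ) : coeff (deriv f) n = (n + 1) * coeff f (n + 1) := by
  have : ((n : ℂ) + 1) ≠ 0 := by exact_mod_cast n.succ_ne_zero
  simp only [coeff, iteratedDeriv_succ', Nat.factorial_succ]
  push_cast
  field_simp

theorem coeff_dilDeriv {r : ℝ} (h0 : 0 ≤ r) (h1 : r < 1) (f : H2) (n : ℕ) :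
    coeff (dilDeriv r h0 h1 f) n
      = (((1 - r) * ((n + 1) * r ^ n) : ℝ) : ℂ) * coeff f (n + 1) := by
  rw [← coeff_backShift, ← coeff_diag (norm_derivWeight_le h0 h1)]
  rfl

theorem dilDeriv_apply {r : ℝ} (h0 : 0 ≤ r) (h1 : r < 1) (f : H2) {z : ℂ}
    (hz : z ∈ ball (0 : ℂ) 1) : dilDeriv r h0 h1 f z = (1 - r) * deriv f (r * z) := by
  refine (rep_coeff (dilDeriv r h0 h1 f).diff z hz).unique ?_
  rw [show (fun n => coeff (dilDeriv r h0 h1 f) n * z ^ n)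
      = fun n => (1 - (r : ℂ)) * (coeff (deriv f) n * (r * z) ^ n) from funext fun n => by
    rw [coeff_dilDeriv, coeff_deriv]
    push_cast
    ring]
  exact (rep_coeff (f.diff.deriv isOpen_ball) _ (mul_mem_ball h0 h1 hz)).mul_left _

theorem tendsto_dil {r : ℕ → ℝ} (h0 : ∀ j, 0 ≤ r j) (h1 : ∀ j, r j < 1)
    (hr : Filter.Tendsto r Filter.atTop (nhds 1)) (f : H2) :
    Filter.Tendsto (fun j => dil (r j) (h0 j) (h1 j) f) Filter.atTop (nhds f) := by
  have hm : ∀ j n, ‖(((r j) ^ n - 1 : ℝ) : ℂ)‖ ≤ 1 := fun j n => by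
    have a := pow_le_one₀ (h0 j) (h1 j).le (n := n)
    have b := pow_nonneg (h0 j) n
    rw [norm_real, Real.norm_eq_abs, abs_le]
    constructor <;> linarith
  have h := tendsto_diag_zero hm (fun n => by
    have : Filter.Tendsto (fun j => (((r j) ^ n - 1 : ℝ) : ℂ)) Filter.atTop
        (nhds ((1 ^ n - 1 : ℝ) : ℂ)) :=
      (continuous_ofReal.tendsto _).comp ((hr.pow n).sub_const 1)
    simpa using this) f
  have h' := h.add_const f
  rw [zero_add] at h'
  refine h'.congr fun j => ext_coeff fun n => ?_
  rw [coeff_add, coeff_diag, dil, coeff_diag]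
  push_cast
  ring

theorem tendsto_dilDeriv {r : ℕ → ℝ} (h0 : ∀ j, 0 ≤ r j) (h1 : ∀ j, r j < 1)
    (hr : Filter.Tendsto r Filter.atTop (nhds 1)) (f : H2) :
    Filter.Tendsto (fun j => dilDeriv (r j) (h0 j) (h1 j) f) Filter.atTop (nhds 0) := by
  refine tendsto_diag_zero (fun j => norm_derivWeight_le (h0 j) (h1 j)) (fun n => ?_) (backShift f)
  have : Filter.Tendsto (fun j => (((1 - r j) * ((n + 1) * (r j) ^ n) : ℝ) : ℂ)) Filter.atTop
      (nhds (((1 - 1) * ((n + 1) * 1 ^ n) : ℝ) : ℂ)) :=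
    (continuous_ofReal.tendsto _).comp
      ((hr.const_sub 1).mul ((hr.pow n).const_mul _))
  simpa using this

/-! ### The kernel of the derivative evaluation -/

theorem exists_derivKernel (w : ball (0 : ℂ) 1) :
    ∃ k : H2, ∀ f : H2, inner ℂ k f = deriv f w := by
  -- With `‖w‖ < r < 1`, the value `f' w` is that of `f' (r ·)` at the point `w / r` of the disc.
  obtain ⟨r, hwr, h1⟩ := exists_between (mem_ball_zero_iff.1 w.2)
  have h0 : 0 < r := (norm_nonneg _).trans_lt hwr
  have hr : (r : ℂ) ≠ 0 := by exact_mod_cast h0.ne'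
  have h1' : (1 - r : ℂ) ≠ 0 := by
    rw [sub_ne_zero]
    exact_mod_cast h1.ne'
  have hv : (w : ℂ) / r ∈ ball (0 : ℂ) 1 := by
    rw [mem_ball_zero_iff, norm_div, norm_real, Real.norm_of_nonneg h0.le, div_lt_one h0]
    exact hwr
  refine ⟨ContinuousLinearMap.adjoint (dilDeriv r h0.le h1)
    ((conj (1 - r : ℂ)⁻¹) • kernel ⟨_, hv⟩), fun f => ?_⟩
  rw [ContinuousLinearMap.adjoint_inner_left, inner_smul_left, inner_kernel,
    dilDeriv_apply h0.le h1 f hv, conj_conj, mul_div_cancel₀ _ hr]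
  field_simp

/-- The element of `H²` representing the functional `f ↦ f' (w)`. -/
noncomputable def derivKernel (w : ball (0 : ℂ) 1) : H2 := (exists_derivKernel w).choose

theorem inner_derivKernel (w : ball (0 : ℂ) 1) (f : H2) :
    inner ℂ (derivKernel w) f = deriv f w :=
  (exists_derivKernel w).choose_spec f

theorem deriv_kernel (w : ball (0 : ℂ) 1) {z : ℂ} (hz : z ∈ ball (0 : ℂ) 1) :
    deriv (kernel w) z = conj (w : ℂ) / (1 - conj (w : ℂ) * z) ^ 2 := by
  have e : (kernel w : ℂ → ℂ) =ᶠ[nhds z] fun z => (1 - conj (w : ℂ) * z)⁻¹ := by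
    filter_upwards [isOpen_ball.mem_nhds hz] with v hv using kernel_apply w hv
  have hd : HasDerivAt (fun z => 1 - conj (w : ℂ) * z) (-(conj (w : ℂ) * 1)) z :=
    ((hasDerivAt_id z).const_mul (conj (w : ℂ))).const_sub 1
  rw [e.deriv_eq, (hd.fun_inv (one_sub_ne (conj_mem w.2) hz)).deriv]
  ring

theorem derivKernel_apply (w : ball (0 : ℂ) 1) {z : ℂ} (hz : z ∈ ball (0 : ℂ) 1) :
    derivKernel w z = z / (1 - conj (w : ℂ) * z) ^ 2 := by
  have h : derivKernel w z = conj (deriv (kernel ⟨z, hz⟩) w) := by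
    rw [← inner_derivKernel, inner_conj_symm, inner_kernel]
  rw [h, deriv_kernel _ w.2]
  simp [mul_comm]

end H2

end Hardy

/-! ### Conjugations on Hilbert spaces -/

namespace Conjugation

variable {E : Type*} [NormedAddCommGroup E] [InnerProductSpace ℂ E]

theorem apply_apply (C : Conjugation E) (x : E) : C.toLinearMap (C.toLinearMap x) = x :=
  C.involutive' x

theorem inner_map_map (C : Conjugation E) (x y : E) :
    inner ℂ (C.toLinearMap x) (C.toLinearMap y) = inner ℂ y x := by
  have hn : ∀ x, ‖C.toLinearMap x‖ = ‖x‖ := C.norm_map'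
  have hI : C.toLinearMap ((I : ℂ) • y) = -((I : ℂ) • C.toLinearMap y) := by
    rw [LinearMap.map_smulₛₗ, conj_I, neg_smul]
  have e1 : C.toLinearMap x - (I : ℂ) • C.toLinearMap y = C.toLinearMap (x + (I : ℂ) • y) := by
    rw [map_add, hI, sub_eq_add_neg]
  have e2 : C.toLinearMap x + (I : ℂ) • C.toLinearMap y = C.toLinearMap (x - (I : ℂ) • y) := by
    rw [map_sub, hI, sub_neg_eq_add]
  rw [← inner_conj_symm y x, inner_eq_sum_norm_sq_div_four (𝕜 := ℂ) (C.toLinearMap x),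
    inner_eq_sum_norm_sq_div_four (𝕜 := ℂ) x]
  simp only [RCLike.I_to_complex, e1, e2, ← map_add, ← map_sub, hn, coe_algebraMap]
  simp only [map_div₀, map_add, map_sub, map_mul, map_pow, conj_ofReal, conj_I, map_ofNat]
  ring

theorem inner_map_right (C : Conjugation E) (x y : E) :
    inner ℂ x (C.toLinearMap y) = inner ℂ y (C.toLinearMap x) := by
  rw [← C.inner_map_map, C.apply_apply]

theorem mem_conjugate_domain {C : Conjugation E} {T : E →ₗ.[ℂ] E} {x : E} :
    x ∈ (C.conjugate T).domain ↔ C.toLinearMap x ∈ T.domain := Iff.rfl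

theorem conjugate_conjugate (C : Conjugation E) (T : E →ₗ.[ℂ] E) :
    C.conjugate (C.conjugate T) = T := by
  refine LinearPMap.ext (Submodule.ext fun x => ?_) fun x hx hx' => ?_
  · rw [mem_conjugate_domain, mem_conjugate_domain, C.apply_apply]
  · change C.toLinearMap (C.toLinearMap (T ⟨C.toLinearMap (C.toLinearMap x), _⟩)) = _
    rw [C.apply_apply]
    congr 2
    exact C.apply_apply x

theorem isCSelfAdjoint_iff [CompleteSpace E] {C : Conjugation E} {T : E →ₗ.[ℂ] E} :
    IsCSelfAdjoint C T ↔ Dense (T.domain : Set E) ∧ T.adjoint = C.conjugate T := by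
  refine and_congr_right fun _ => ⟨fun h => ?_, fun h => ?_⟩
  · conv_rhs => rw [h]
    rw [conjugate_conjugate]
  · rw [h, conjugate_conjugate]

end Conjugation

namespace Hardy

variable {β lam : ℂ} {ψ₀ ψ₁ : ℂ → ℂ}

/-! ### Kernel functions and the differential expression -/

theorem diffExpr_apply (ψ₀ ψ₁ f : ℂ → ℂ) {z : ℂ} (hz : z ∈ ball (0 : ℂ) 1) :
    diffExpr ψ₀ ψ₁ f z = ψ₀ z * f z + ψ₁ z * deriv f z :=
  Set.indicator_of_mem hz _

theorem isHardy_of_eqOn {f : ℂ → ℂ} (g : H2) (h0 : ∀ z ∉ ball (0 : ℂ) 1, f z = 0)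
    (h : ∀ z ∈ ball (0 : ℂ) 1, f z = g z) : IsHardy f := by
  have : f = g := by
    funext z
    by_cases hz : z ∈ ball (0 : ℂ) 1
    · exact h z hz
    · rw [h0 z hz, g.2.2.2 z hz]
  rw [this]
  exact g.2

theorem mem_maxOp_domain_of_eqOn {f : H2} (g : H2)
    (h : ∀ z ∈ ball (0 : ℂ) 1, diffExpr ψ₀ ψ₁ f z = g z) :
    ∃ hf : f ∈ (maxOp ψ₀ ψ₁).domain, maxOp ψ₀ ψ₁ ⟨f, hf⟩ = g :=
  ⟨isHardy_of_eqOn g (fun _ hz => Set.indicator_of_notMem hz _) h, H2.ext_fun h⟩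

/-- The element of `H²` representing the functional `f ↦ ψ₀ w * f w + ψ₁ w * f' w`. -/
noncomputable def exprKernel (ψ₀ ψ₁ : ℂ → ℂ) (w : ball (0 : ℂ) 1) : H2 :=
  conj (ψ₀ w) • H2.kernel w + conj (ψ₁ w) • H2.derivKernel w

theorem inner_exprKernel (w : ball (0 : ℂ) 1) (f : H2) :
    inner ℂ (exprKernel ψ₀ ψ₁ w) f = diffExpr ψ₀ ψ₁ f w := by
  rw [exprKernel, inner_add_left, inner_smul_left, inner_smul_left, H2.inner_kernel,
    H2.inner_derivKernel, conj_conj, conj_conj, diffExpr_apply _ _ _ w.2]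

/-- Every kernel function lies in the domain of the adjoint, whatever the coefficients are. -/
theorem adjoint_kernel (hd : Dense ((maxOp ψ₀ ψ₁).domain : Set H2)) (w : ball (0 : ℂ) 1) :
    ∃ hw : H2.kernel w ∈ (maxOp ψ₀ ψ₁).adjoint.domain,
      (maxOp ψ₀ ψ₁).adjoint ⟨H2.kernel w, hw⟩ = exprKernel ψ₀ ψ₁ w := by
  have h : ∀ f : (maxOp ψ₀ ψ₁).domain,
      inner ℂ (exprKernel ψ₀ ψ₁ w) (f : H2) = inner ℂ (H2.kernel w) (maxOp ψ₀ ψ₁ f) :=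
    fun f => by
      rw [inner_exprKernel, H2.inner_kernel]
      rfl
  exact ⟨LinearPMap.mem_adjoint_domain_of_exists _ ⟨_, h⟩, LinearPMap.adjoint_apply_eq hd _ h⟩

theorem conjJ_apply (hβ : ‖β‖ = 1) (h0 : lam ≠ 0) (h1 : ‖lam‖ < 1) (f : H2) {z : ℂ}
    (hz : z ∈ ball (0 : ℂ) 1) :
    (conjJ β lam hβ h0 h1).toLinearMap f z = β * kappa lam z * conj (f (conj (phi lam z))) := by
  change jFun β lam f z = _
  rw [jFun, Set.indicator_of_mem hz]

theorem conjJ_kernel (hβ : ‖β‖ = 1) (h0 : lam ≠ 0) (h1 : ‖lam‖ < 1) (w : ball (0 : ℂ) 1) :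
    (conjJ β lam hβ h0 h1).toLinearMap (H2.kernel w)
      = (β * kappa lam w) • H2.kernel (phiPt h0 h1 w) := by
  refine H2.ext_fun fun z hz => ?_
  rw [conjJ_apply hβ h0 h1 _ hz, H2.coe_smul, Pi.smul_apply, smul_eq_mul,
    H2.kernel_apply _ (conj_mem (phi_mem h0 h1 hz)), H2.kernel_apply _ hz]
  have hs := phi_symm h0 h1 hz w.2
  simp only [phiPt, conj_conj, map_mul, map_inv₀, map_sub, map_one]
  linear_combination β * hs

theorem kappa_ne_zero (h1 : ‖lam‖ < 1) {z : ℂ} (hz : z ∈ ball (0 : ℂ) 1) :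
    kappa lam z ≠ 0 := by
  refine div_ne_zero ?_ (den_ne h1 hz)
  have : 0 < 1 - ‖lam‖ ^ 2 := by nlinarith [norm_nonneg lam]
  exact_mod_cast (Real.sqrt_pos.2 this).ne'

theorem kernel_eq_smul_conjJ_kernel (hβ : ‖β‖ = 1) (h0 : lam ≠ 0) (h1 : ‖lam‖ < 1)
    (w : ball (0 : ℂ) 1) : ∃ (c : ℂ) (v : ball (0 : ℂ) 1),
      H2.kernel w = c • (conjJ β lam hβ h0 h1).toLinearMap (H2.kernel v) := by
  have hb : β ≠ 0 := by
    rintro rfl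
    simp at hβ
  have e : phiPt h0 h1 (phiPt h0 h1 w) = w := Subtype.ext (phi_conj_phi h0 h1 w.2)
  refine ⟨(β * kappa lam (phiPt h0 h1 w))⁻¹, phiPt h0 h1 w, ?_⟩
  rw [conjJ_kernel, e, inv_smul_smul₀ (mul_ne_zero hb (kappa_ne_zero h1 (phiPt h0 h1 w).2))]

/-- The relation `E J K_w = J E* K_w` between the values at `u`, cleared of denominators.  The
expression multiplying `ψ₀ u - ψ₀ w` is `lam * (1 - w * conj lam) * (1 - phi lam w * u)`, which is
symmetric in `u` and `w`. -/
def SymmAt (lam : ℂ) (ψ₀ ψ₁ : ℂ → ℂ) (u w : ℂ) : Prop :=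
  (ψ₀ u - ψ₀ w) * (lam - lam * conj lam * w - lam * conj lam * u + conj lam * w * u)
    + ψ₁ u * conj lam * (lam - w) - ψ₁ w * conj lam * (lam - u) = 0

theorem diffExpr_conjJ_kernel_iff (hβ : ‖β‖ = 1) (h0 : lam ≠ 0) (h1 : ‖lam‖ < 1)
    (w : ball (0 : ℂ) 1) {u : ℂ} (hu : u ∈ ball (0 : ℂ) 1) :
    diffExpr ψ₀ ψ₁ ((conjJ β lam hβ h0 h1).toLinearMap (H2.kernel w)) u
        = (conjJ β lam hβ h0 h1).toLinearMap (exprKernel ψ₀ ψ₁ w) u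
      ↔ SymmAt lam ψ₀ ψ₁ u w := by
  have hb : β ≠ 0 := by
    rintro rfl
    simp at hβ
  have hk := kappa_ne_zero h1 w.2
  have hs := phi_symm h0 h1 hu w.2
  have n1 := one_sub_ne w.2 (phi_mem h0 h1 hu)
  have n2 := one_sub_ne (phi_mem h0 h1 w.2) hu
  have d1 := den_ne h1 hu
  have d2 := den_ne h1 w.2
  have ed : deriv ((conjJ β lam hβ h0 h1).toLinearMap (H2.kernel w)) u
      = β * kappa lam w * (phi lam w / (1 - phi lam w * u) ^ 2) := by
    rw [conjJ_kernel]
    have hf := (H2.kernel (phiPt h0 h1 w)).diff.differentiableAt (isOpen_ball.mem_nhds hu)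
    rw [H2.coe_smul, deriv_const_smul _ hf, H2.deriv_kernel _ hu]
    simp [phiPt]
  have ev : (conjJ β lam hβ h0 h1).toLinearMap (H2.kernel w) u
      = β * kappa lam w * (1 - phi lam w * u)⁻¹ := by
    rw [conjJ_kernel, H2.coe_smul, Pi.smul_apply, H2.kernel_apply _ hu]
    simp [phiPt]
  have eR : (conjJ β lam hβ h0 h1).toLinearMap (exprKernel ψ₀ ψ₁ w) u
      = β * kappa lam u * (ψ₀ w * (1 - w * phi lam u)⁻¹
        + ψ₁ w * (phi lam u / (1 - w * phi lam u) ^ 2)) := by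
    rw [conjJ_apply hβ h0 h1 _ hu, exprKernel, H2.coe_add, H2.coe_smul, H2.coe_smul]
    simp only [Pi.add_apply, Pi.smul_apply, smul_eq_mul]
    rw [H2.kernel_apply _ (conj_mem (phi_mem h0 h1 hu)),
      H2.derivKernel_apply _ (conj_mem (phi_mem h0 h1 hu))]
    simp
  -- Both sides carry the common factor `κ(w) (1 - φ(w) u)⁻¹ = κ(u) (1 - w φ(u))⁻¹`.
  have eR' : β * kappa lam u * (ψ₀ w * (1 - w * phi lam u)⁻¹
        + ψ₁ w * (phi lam u / (1 - w * phi lam u) ^ 2))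
      = β * (kappa lam w * (1 - phi lam w * u)⁻¹)
        * (ψ₀ w + ψ₁ w * (phi lam u / (1 - w * phi lam u))) := by
    rw [← hs]
    field_simp
  have eL : ψ₀ u * (β * kappa lam w * (1 - phi lam w * u)⁻¹)
        + ψ₁ u * (β * kappa lam w * (phi lam w / (1 - phi lam w * u) ^ 2))
      = β * (kappa lam w * (1 - phi lam w * u)⁻¹)
        * (ψ₀ u + ψ₁ u * (phi lam w / (1 - phi lam w * u))) := by
    field_simp
  have hD : ∀ {x y : ℂ}, 1 - y * conj lam ≠ 0 →
      lam * (1 - y * conj lam) * (1 - phi lam y * x)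
        = lam - lam * conj lam * y - lam * conj lam * x + conj lam * y * x := by
    intro x y hy
    simp only [phi]
    field_simp
    ring
  have hφ : ∀ {x y : ℂ}, 1 - y * conj lam ≠ 0 →
      lam * (1 - y * conj lam) * phi lam y = conj lam * (lam - y) := by
    intro x y hy
    simp only [phi]
    field_simp
  set D := lam - lam * conj lam * w - lam * conj lam * u + conj lam * w * u with hDdef
  have hD1 : lam * (1 - w * conj lam) * (1 - phi lam w * u) = D := hD d2
  have hD2 : lam * (1 - u * conj lam) * (1 - w * phi lam u) = D := by
    rw [mul_comm (w : ℂ), hD d1, hDdef]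
    ring
  have hD0 : D ≠ 0 := hD1 ▸ mul_ne_zero (mul_ne_zero h0 d2) n2
  have q1 : phi lam w / (1 - phi lam w * u) = conj lam * (lam - w) / D := by
    rw [← hD1, ← hφ (x := 0) d2, mul_div_mul_left _ _ (mul_ne_zero h0 d2)]
  have q2 : phi lam u / (1 - w * phi lam u) = conj lam * (lam - u) / D := by
    rw [← hD2, ← hφ (x := 0) d1, mul_div_mul_left _ _ (mul_ne_zero h0 d1)]
  rw [diffExpr_apply _ _ _ hu, ed, ev, eR, eR', eL,
    mul_right_inj' (mul_ne_zero hb (mul_ne_zero hk (inv_ne_zero n2))), q1, q2, SymmAt, ← hDdef,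
    ← sub_eq_zero]
  have e : ψ₀ u + ψ₁ u * (conj lam * (lam - w) / D)
        - (ψ₀ w + ψ₁ w * (conj lam * (lam - u) / D))
      = ((ψ₀ u - ψ₀ w) * D + ψ₁ u * conj lam * (lam - w) - ψ₁ w * conj lam * (lam - u)) / D := by
    field_simp
    ring
  rw [e, div_eq_zero_iff, or_iff_left hD0]

/-! ### Solving the functional equation -/

/-- The functional equation forces the coefficients: at `w = lam`, a point of the disc, it says
that `ψ₀` is affine, and at `w = 0` it then gives `ψ₁`. -/
theorem exists_coeffs_of_symmAt (h0 : lam ≠ 0) (h1 : ‖lam‖ < 1)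
    (h : ∀ u ∈ ball (0 : ℂ) 1, ∀ w ∈ ball (0 : ℂ) 1, SymmAt lam ψ₀ ψ₁ u w) :
    ∃ a b c d : ℂ, d = -lam * b / conj lam - lam * c ∧
      ∀ u ∈ ball (0 : ℂ) 1, ψ₀ u = a + b * u ∧ ψ₁ u = d + c * u + b * u ^ 2 := by
  have hl : lam ∈ ball (0 : ℂ) 1 := by simpa using h1
  have hz : (0 : ℂ) ∈ ball (0 : ℂ) 1 := by simp
  have c0 : conj lam ≠ 0 := (map_ne_zero _).2 h0
  have hq := den_ne h1 hl
  set b := -ψ₁ lam * conj lam / (lam * (1 - lam * conj lam)) with hb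
  have key : ∀ u ∈ ball (0 : ℂ) 1, ψ₀ u = ψ₀ 0 + b * u := by
    have aux : ∀ u ∈ ball (0 : ℂ) 1, ψ₀ u = ψ₀ lam - b * lam + b * u := by
      intro u hu
      have e := h u hu lam hl
      rw [SymmAt] at e
      rw [← sub_eq_zero]
      have : lam * (1 - lam * conj lam) ≠ 0 := mul_ne_zero h0 hq
      refine (mul_eq_zero.1 ?_).resolve_left this
      have hb' : b * (lam * (1 - lam * conj lam)) = -ψ₁ lam * conj lam := by
        rw [hb, div_mul_cancel₀ _ this]
      linear_combination e + (lam - u) * hb'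
    intro u hu
    rw [aux u hu, aux 0 hz]
    ring
  refine ⟨ψ₀ 0, b, -(ψ₁ 0) / lam - b / conj lam, ψ₁ 0, ?_, fun u hu => ⟨key u hu, ?_⟩⟩
  · field_simp
    ring
  · have e := h u hu 0 hz
    rw [SymmAt, key u hu] at e
    field_simp
    linear_combination e

theorem symmAt_of_coeffs (h0 : lam ≠ 0) {a b c d : ℂ}
    (hd : d = -lam * b / conj lam - lam * c)
    (h : ∀ u ∈ ball (0 : ℂ) 1, ψ₀ u = a + b * u ∧ ψ₁ u = d + c * u + b * u ^ 2)
    {u w : ℂ} (hu : u ∈ ball (0 : ℂ) 1) (hw : w ∈ ball (0 : ℂ) 1) : SymmAt lam ψ₀ ψ₁ u w := by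
  have c0 : conj lam ≠ 0 := (map_ne_zero _).2 h0
  rw [SymmAt, (h u hu).1, (h u hu).2, (h w hw).1, (h w hw).2, hd]
  field_simp
  ring

/-! ### Dilations approximate in the graph norm -/

/-- For quadratic coefficients, the differential operator composed with a dilation is bounded. -/
theorem exists_diffExpr_dil {a b c d : ℂ}
    (h : ∀ u ∈ ball (0 : ℂ) 1, ψ₀ u = a + b * u ∧ ψ₁ u = d + c * u + b * u ^ 2)
    {r : ℝ} (h0 : 0 ≤ r) (h1 : r < 1) :
    ∃ T : H2 →L[ℂ] H2, ∀ (f : H2), ∀ z ∈ ball (0 : ℂ) 1,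
      diffExpr ψ₀ ψ₁ (H2.dil r h0 h1 f) z = T f z := by
  have hr : (1 - r : ℂ) ≠ 0 := by
    rw [sub_ne_zero]
    exact_mod_cast h1.ne'
  -- The derivative of `f (r ·)` is `r f' (r ·)`, while `dilDeriv` produces `(1 - r) f' (r ·)`.
  refine ⟨a • H2.dil r h0 h1 + b • H2.shift.comp (H2.dil r h0 h1)
    + (r / (1 - r) : ℂ) • (d • H2.dilDeriv r h0 h1 + c • H2.shift.comp (H2.dilDeriv r h0 h1)
      + b • H2.shift.comp (H2.shift.comp (H2.dilDeriv r h0 h1))), fun f z hz => ?_⟩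
  rw [diffExpr_apply _ _ _ hz, (h z hz).1, (h z hz).2, H2.deriv_dil h0 h1 f hz]
  simp only [_root_.add_apply, _root_.smul_apply,
    ContinuousLinearMap.comp_apply, H2.coe_add, H2.coe_smul, Pi.add_apply, Pi.smul_apply,
    smul_eq_mul, H2.shift_apply _ hz, H2.dilDeriv_apply h0 h1 f hz]
  field_simp

/-- For quadratic coefficients, the dilations `f (r ·)` of an element `f` of the maximal domain
converge to `f` in the graph norm: the commutator of the differential expression with the dilation
is `(1 - r)` times a first-order expression in `f (r ·)`, and `(1 - r) f' (r ·) → 0` in `H²`. -/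
theorem tendsto_maxOp_dil {a b c d : ℂ}
    (h : ∀ u ∈ ball (0 : ℂ) 1, ψ₀ u = a + b * u ∧ ψ₁ u = d + c * u + b * u ^ 2)
    {r : ℕ → ℝ} (h0 : ∀ j, 0 ≤ r j) (h1 : ∀ j, r j < 1)
    (hr : Filter.Tendsto r Filter.atTop (nhds 1)) (f : (maxOp ψ₀ ψ₁).domain) {g : ℕ → H2}
    (hg : ∀ j, ∀ z ∈ ball (0 : ℂ) 1,
      diffExpr ψ₀ ψ₁ (H2.dil (r j) (h0 j) (h1 j) (f : H2)) z = g j z) :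
    Filter.Tendsto g Filter.atTop (nhds (maxOp ψ₀ ψ₁ f)) := by
  have e : ∀ j, H2.dil (r j) (h0 j) (h1 j) (maxOp ψ₀ ψ₁ f)
      + ((1 - r j : ℂ) • b • H2.shift (H2.dil (r j) (h0 j) (h1 j) (f : H2))
      - d • H2.dilDeriv (r j) (h0 j) (h1 j) (f : H2)
      + (r j : ℂ) • b • H2.shift (H2.shift (H2.dilDeriv (r j) (h0 j) (h1 j) (f : H2)))) = g j := by
    refine fun j => H2.ext_fun fun z hz => ?_
    have hz' := H2.mul_mem_ball (h0 j) (h1 j) hz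
    rw [← hg j z hz, sub_eq_add_neg, ← neg_smul]
    simp only [H2.coe_add, H2.coe_smul, Pi.add_apply, Pi.smul_apply,
      smul_eq_mul, H2.shift_apply _ hz, H2.dilDeriv_apply (h0 j) (h1 j) _ hz]
    rw [H2.dil_apply (h0 j) (h1 j) _ hz]
    change diffExpr ψ₀ ψ₁ (f : H2) (r j * z) + _ = _
    rw [diffExpr_apply _ _ _ hz', diffExpr_apply _ _ _ hz, (h z hz).1, (h z hz).2, (h _ hz').1,
      (h _ hz').2, H2.deriv_dil (h0 j) (h1 j) _ hz, H2.dil_apply (h0 j) (h1 j) _ hz]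
    ring
  have hrc : Filter.Tendsto (fun j => (r j : ℂ)) Filter.atTop (nhds ((1 : ℝ) : ℂ)) :=
    (continuous_ofReal.tendsto _).comp hr
  have hD := H2.tendsto_dil h0 h1 hr
  have hN := H2.tendsto_dilDeriv h0 h1 hr (f : H2)
  have hS : ∀ {x : ℕ → H2} {y : H2}, Filter.Tendsto x Filter.atTop (nhds y) →
      Filter.Tendsto (fun j => H2.shift (x j)) Filter.atTop (nhds (H2.shift y)) :=
    fun hx => (H2.shift.continuous.tendsto _).comp hx
  have lim := (hD (maxOp ψ₀ ψ₁ f)).add (((hrc.const_sub 1).smul ((hS (hD f)).const_smul b)).sub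
    (hN.const_smul d) |>.add (hrc.smul ((hS (hS hN)).const_smul b)))
  simp only [e] at lim
  simpa using lim

/-! ### Complex selfadjointness -/

/-- `E J K_w = J E* K_w`, where `E* K_w` is the element representing `f ↦ (E f) (w)`. -/
theorem maxOp_conjJ_kernel (hβ : ‖β‖ = 1) (h0 : lam ≠ 0) (h1 : ‖lam‖ < 1)
    (h : ∀ u ∈ ball (0 : ℂ) 1, ∀ w ∈ ball (0 : ℂ) 1, SymmAt lam ψ₀ ψ₁ u w)
    (w : ball (0 : ℂ) 1) :
    ∃ hw : (conjJ β lam hβ h0 h1).toLinearMap (H2.kernel w) ∈ (maxOp ψ₀ ψ₁).domain,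
      maxOp ψ₀ ψ₁ ⟨_, hw⟩ = (conjJ β lam hβ h0 h1).toLinearMap (exprKernel ψ₀ ψ₁ w) :=
  mem_maxOp_domain_of_eqOn _ fun u hu =>
    (diffExpr_conjJ_kernel_iff hβ h0 h1 w hu).2 (h u hu w w.2)

theorem symmAt_of_adjoint_le (hβ : ‖β‖ = 1) (h0 : lam ≠ 0) (h1 : ‖lam‖ < 1)
    (hd : Dense ((maxOp ψ₀ ψ₁).domain : Set H2))
    (hle : (maxOp ψ₀ ψ₁).adjoint ≤ (conjJ β lam hβ h0 h1).conjugate (maxOp ψ₀ ψ₁))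
    {u w : ℂ} (hu : u ∈ ball (0 : ℂ) 1) (hw : w ∈ ball (0 : ℂ) 1) : SymmAt lam ψ₀ ψ₁ u w := by
  obtain ⟨hk, ek⟩ := adjoint_kernel hd ⟨w, hw⟩
  have e := hle.2 (x := ⟨_, hk⟩) (y := ⟨_, hle.1 hk⟩) rfl
  rw [ek] at e
  have e' := congrArg (conjJ β lam hβ h0 h1).toLinearMap e
  refine (diffExpr_conjJ_kernel_iff hβ h0 h1 ⟨w, hw⟩ hu).1 ?_
  rw [e']
  change _ = (conjJ β lam hβ h0 h1).toLinearMap ((conjJ β lam hβ h0 h1).toLinearMap _) u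
  rw [Conjugation.apply_apply]
  rfl

theorem dense_maxOp_domain (hβ : ‖β‖ = 1) (h0 : lam ≠ 0) (h1 : ‖lam‖ < 1)
    (h : ∀ u ∈ ball (0 : ℂ) 1, ∀ w ∈ ball (0 : ℂ) 1, SymmAt lam ψ₀ ψ₁ u w) :
    Dense ((maxOp ψ₀ ψ₁).domain : Set H2) := by
  refine Dense.mono ?_ H2.denseRange_kernel
  rintro _ ⟨s, rfl⟩
  rw [Finsupp.linearCombination_apply]
  refine Submodule.sum_mem _ fun w _ => Submodule.smul_mem _ _ ?_
  obtain ⟨c, v, e⟩ := kernel_eq_smul_conjJ_kernel hβ h0 h1 w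
  rw [e]
  exact Submodule.smul_mem _ _ (maxOp_conjJ_kernel hβ h0 h1 h v).1

theorem adjoint_le_conjugate (hβ : ‖β‖ = 1) (h0 : lam ≠ 0) (h1 : ‖lam‖ < 1)
    (h : ∀ u ∈ ball (0 : ℂ) 1, ∀ w ∈ ball (0 : ℂ) 1, SymmAt lam ψ₀ ψ₁ u w)
    (hd : Dense ((maxOp ψ₀ ψ₁).domain : Set H2)) :
    (maxOp ψ₀ ψ₁).adjoint ≤ (conjJ β lam hβ h0 h1).conjugate (maxOp ψ₀ ψ₁) := by
  set J := conjJ β lam hβ h0 h1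
  -- Test the adjoint relation on the functions `J K_w`.
  have key : ∀ f : (maxOp ψ₀ ψ₁).adjoint.domain, ∀ w ∈ ball (0 : ℂ) 1,
      diffExpr ψ₀ ψ₁ (J.toLinearMap f) w = J.toLinearMap ((maxOp ψ₀ ψ₁).adjoint f) w := by
    intro f w hw
    obtain ⟨hk, ek⟩ := maxOp_conjJ_kernel hβ h0 h1 h ⟨w, hw⟩
    have e := LinearPMap.adjoint_isFormalAdjoint hd f ⟨_, hk⟩
    rw [ek] at e
    rw [← inner_exprKernel ⟨w, hw⟩, J.inner_map_right, ← H2.inner_kernel ⟨w, hw⟩,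
      J.inner_map_right (H2.kernel _)]
    exact e.symm
  refine ⟨fun f hf => (mem_maxOp_domain_of_eqOn _ (key ⟨f, hf⟩)).1, fun f g hfg => ?_⟩
  obtain ⟨hk, ek⟩ := mem_maxOp_domain_of_eqOn _ (key f)
  have : (conjJ β lam hβ h0 h1).conjugate (maxOp ψ₀ ψ₁) g
      = J.toLinearMap (maxOp ψ₀ ψ₁ ⟨J.toLinearMap f, hk⟩) := by
    obtain ⟨g, hg⟩ := g
    obtain rfl : (f : H2) = g := hfg
    rfl
  rw [this, ek, J.apply_apply]

/-- The form `(f, g) ↦ ⟪J g, f⟫` is symmetric with respect to the maximal operator.  After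
dilation both sides depend continuously on `f`, and for kernel functions the identity is the
relation `E J K_w = J E* K_w`. -/
theorem inner_conjJ_maxOp (hβ : ‖β‖ = 1) (h0 : lam ≠ 0) (h1 : ‖lam‖ < 1) {a b c d : ℂ}
    (hc : ∀ u ∈ ball (0 : ℂ) 1, ψ₀ u = a + b * u ∧ ψ₁ u = d + c * u + b * u ^ 2)
    (h : ∀ u ∈ ball (0 : ℂ) 1, ∀ w ∈ ball (0 : ℂ) 1, SymmAt lam ψ₀ ψ₁ u w)
    (f g : (maxOp ψ₀ ψ₁).domain) :
    inner ℂ ((conjJ β lam hβ h0 h1).toLinearMap (g : H2)) (maxOp ψ₀ ψ₁ f)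
      = inner ℂ ((conjJ β lam hβ h0 h1).toLinearMap (maxOp ψ₀ ψ₁ g)) (f : H2) := by
  set J := conjJ β lam hβ h0 h1
  obtain ⟨r, -, hr01, hr⟩ := exists_seq_strictMono_tendsto' (show (0 : ℝ) < 1 by norm_num)
  have r0 : ∀ j, 0 ≤ r j := fun j => (hr01 j).1.le
  have r1 : ∀ j, r j < 1 := fun j => (hr01 j).2
  choose T hT using fun j => exists_diffExpr_dil hc (r0 j) (r1 j)
  -- The identity for kernel functions, which are multiples of functions `J K_v`.
  have base : ∀ (w : ball (0 : ℂ) 1) (k : H2),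
      (∀ z ∈ ball (0 : ℂ) 1, diffExpr ψ₀ ψ₁ (H2.kernel w) z = k z) →
      inner ℂ (J.toLinearMap (g : H2)) k
        = inner ℂ (J.toLinearMap (maxOp ψ₀ ψ₁ g)) (H2.kernel w) := by
    intro w k hk
    obtain ⟨s, v, e⟩ := kernel_eq_smul_conjJ_kernel hβ h0 h1 w
    obtain ⟨hv, ev⟩ := maxOp_conjJ_kernel hβ h0 h1 h v
    have ek : k = s • J.toLinearMap (exprKernel ψ₀ ψ₁ v) := by
      refine H2.ext_fun fun z hz => ?_
      rw [← hk z hz, e, diffExpr_smul, ← ev]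
      rfl
    rw [ek, e, inner_smul_right, inner_smul_right]
    change s * inner ℂ (J.toLinearMap _) (J.toLinearMap _)
      = s * inner ℂ (J.toLinearMap _) (J.toLinearMap _)
    rw [J.inner_map_map, J.inner_map_map, inner_exprKernel, H2.inner_kernel]
    rfl
  have step : ∀ j (x : H2), inner ℂ (J.toLinearMap (g : H2)) (T j x)
      = inner ℂ (J.toLinearMap (maxOp ψ₀ ψ₁ g)) (H2.dil (r j) (r0 j) (r1 j) x) := by
    intro j x
    refine H2.denseRange_kernel.induction_on (p := fun x : H2 =>
      inner ℂ (J.toLinearMap (g : H2)) (T j x)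
        = inner ℂ (J.toLinearMap (maxOp ψ₀ ψ₁ g)) (H2.dil (r j) (r0 j) (r1 j) x)) x ?_ ?_
    · exact isClosed_eq (by fun_prop) (by fun_prop)
    · intro s
      rw [Finsupp.linearCombination_apply, Finsupp.sum, map_sum, map_sum, inner_sum, inner_sum]
      refine Finset.sum_congr rfl fun w _ => ?_
      rw [map_smul, map_smul, inner_smul_right, inner_smul_right, H2.dil_kernel,
        base _ (T j (H2.kernel w)) fun z hz => by rw [← H2.dil_kernel, hT j _ z hz]]
  have lim1 := (tendsto_const_nhds (x := J.toLinearMap (g : H2))).inner (𝕜 := ℂ)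
    (tendsto_maxOp_dil hc r0 r1 hr f (g := fun j => T j f) fun j => hT j f)
  have lim2 := (tendsto_const_nhds (x := J.toLinearMap (maxOp ψ₀ ψ₁ g))).inner (𝕜 := ℂ)
    (H2.tendsto_dil r0 r1 hr (f : H2))
  simp only [step] at lim1
  exact tendsto_nhds_unique lim1 lim2

theorem conjugate_le_adjoint (hβ : ‖β‖ = 1) (h0 : lam ≠ 0) (h1 : ‖lam‖ < 1) {a b c d : ℂ}
    (hc : ∀ u ∈ ball (0 : ℂ) 1, ψ₀ u = a + b * u ∧ ψ₁ u = d + c * u + b * u ^ 2)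
    (h : ∀ u ∈ ball (0 : ℂ) 1, ∀ w ∈ ball (0 : ℂ) 1, SymmAt lam ψ₀ ψ₁ u w)
    (hd : Dense ((maxOp ψ₀ ψ₁).domain : Set H2)) :
    (conjJ β lam hβ h0 h1).conjugate (maxOp ψ₀ ψ₁) ≤ (maxOp ψ₀ ψ₁).adjoint := by
  refine LinearPMap.IsFormalAdjoint.le_adjoint hd fun f g => ?_
  have e := inner_conjJ_maxOp hβ h0 h1 hc h f ⟨_, g.2⟩
  rw [Conjugation.apply_apply] at e
  rw [← inner_conj_symm, e, inner_conj_symm]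
  rfl

end Hardy

theorem mainTheorem2 (β lam : ℂ) (hβ : ‖β‖ = 1) (hlam0 : lam ≠ 0) (hlam1 : ‖lam‖ < 1)
    (ψ₀ ψ₁ : ℂ → ℂ) (hψ₀ : DifferentiableOn ℂ ψ₀ (Metric.ball 0 1))
    (hψ₁ : DifferentiableOn ℂ ψ₁ (Metric.ball 0 1)) :
    List.TFAE
      [IsCSelfAdjoint (Hardy.conjJ β lam hβ hlam0 hlam1) (Hardy.maxOp ψ₀ ψ₁),
       Dense ((Hardy.maxOp ψ₀ ψ₁).domain : Set Hardy.H2) ∧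
         (Hardy.maxOp ψ₀ ψ₁).adjoint ≤
           (Hardy.conjJ β lam hβ hlam0 hlam1).conjugate (Hardy.maxOp ψ₀ ψ₁),
       ∃ a b c d : ℂ, d = -lam * b / (starRingEnd ℂ) lam - lam * c ∧
         ∀ u ∈ Metric.ball (0 : ℂ) 1, ψ₀ u = a + b * u ∧ ψ₁ u = d + c * u + b * u ^ 2] := by
  rw [Conjugation.isCSelfAdjoint_iff]
  tfae_have 1 → 2 := fun h => ⟨h.1, h.2.le⟩
  tfae_have 2 → 3 := fun h => Hardy.exists_coeffs_of_symmAt hlam0 hlam1 fun u hu w hw =>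
    Hardy.symmAt_of_adjoint_le hβ hlam0 hlam1 h.1 h.2 hu hw
  tfae_have 3 → 1 := by
    rintro ⟨a, b, c, d, hd, hc⟩
    have hs : ∀ u ∈ ball (0 : ℂ) 1, ∀ w ∈ ball (0 : ℂ) 1, Hardy.SymmAt lam ψ₀ ψ₁ u w :=
      fun u hu w hw => Hardy.symmAt_of_coeffs hlam0 hd hc hu hw
    have hD := Hardy.dense_maxOp_domain hβ hlam0 hlam1 hs
    exact ⟨hD, le_antisymm (Hardy.adjoint_le_conjugate hβ hlam0 hlam1 hs hD)
      (Hardy.conjugate_le_adjoint hβ hlam0 hlam1 hc hs hD)⟩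
  tfae_finish
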